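/- Let $a_1,a_2,a_3,b_1,b_2,c_1,c_2\in\mathbb{C}$ and let $$F_N=\sum_{m_1,m_2,m_3\ge 0}\frac{(a_1)_{m_1}(a_2)_{m_2}(a_3)_{m_3}\,(b_1)_{m_1+m_3}(b_2)_{m_2}}{(c_1)_{m_1}(c_2)_{m_2+m_3}}\,\frac{z_1^{m_1}z_2^{m_2}z_3^{m_3}}{m_1!\,m_2!\,m_3!}$$ be the Lauricella–Saran hypergeometric series. With $\theta_j=z_j\,\partial/\partial z_j$, its system of differential equations is $L_1F=L_2F=L_3F=0$, where $$L_1=(\theta_1+1)(\theta_1+c_1)\tfrac1{z_1}-(\theta_1+a_1)(\theta_1+\theta_3+b_1),$$ $$L_2=(\theta_2+1)(\theta_2+\theta_3+c_2)\tfrac1{z_2}-(\theta_2+a_2)(\theta_2+b_2),$$ $$L_3=(\theta_3+1)(\theta_2+\theta_3+c_2)\tfrac1{z_3}-(\theta_3+a_3)(\theta_1+\theta_3+b_1)$$ (this system makes sense for all complex parameters, also when $c_1$ or $c_2$ is a nonpositive integer and the series is not defined). Let $R=\mathbb{C}(z_1,z_2,z_3)\langle\partial_1,\partial_2,\partial_3\rangle$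 be the algebra of linear partial differential operators with rational coefficients, and call the system reducible if the left $R$-module $R/(RL_1+RL_2+RL_3)$ has a submodule other than $0$ and the whole module. If at least one of the numbers $$a_1,\quad a_2,\quad a_3,\quad b_1,\quad b_2,\quad a_2-c_1-c_2+b_1,\quad a_2-c_2+b_1,\quad b_2-c_1-c_2+b_1,\quad b_2-c_2+b_1$$ is an integer, then the system is reducible. -/

import Mathlib

namespace FNSystem

/-- The field `ℂ(z₁, z₂, z₃)` of rational functions in three variables; the variables are indexed
by `0, 1, 2 : Fin 3`. -/
abbrev RatFun : Type := FractionRing (MvPolynomial (Fin 3) ℂ)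

/-- The variable `z_{i+1}`, as a rational function. -/
noncomputable def z (i : Fin 3) : RatFun :=
  algebraMap (MvPolynomial (Fin 3) ℂ) RatFun (MvPolynomial.X i)

/-- The free associative `ℂ`-algebra on the rational functions (`Sum.inl f`) and on three
further symbols `∂₁, ∂₂, ∂₃` (`Sum.inr i`). -/
abbrev FreeOp : Type := FreeAlgebra ℂ (RatFun ⊕ Fin 3)

/-- The defining relations of the algebra of linear partial differential operators with rational
coefficients: rational functions are added and multiplied as usual, the partial derivatives
commute with each other, and `∂ᵢ p = p ∂ᵢ + ∂p/∂zᵢ` for every polynomial `p`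
(which forces the Leibniz rule for every rational function). -/
inductive OpRel : FreeOp → FreeOp → Prop
  | add (f g : RatFun) : OpRel
      (FreeAlgebra.ι ℂ (Sum.inl (f + g)))
      (FreeAlgebra.ι ℂ (Sum.inl f) + FreeAlgebra.ι ℂ (Sum.inl g))
  | mul (f g : RatFun) : OpRel
      (FreeAlgebra.ι ℂ (Sum.inl (f * g)))
      (FreeAlgebra.ι ℂ (Sum.inl f) * FreeAlgebra.ι ℂ (Sum.inl g))
  | const (r : ℂ) : OpRel
      (FreeAlgebra.ι ℂ (Sum.inl (algebraMap ℂ RatFun r)))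
      (algebraMap ℂ FreeOp r)
  | comm (i j : Fin 3) : OpRel
      (FreeAlgebra.ι ℂ (Sum.inr i) * FreeAlgebra.ι ℂ (Sum.inr j))
      (FreeAlgebra.ι ℂ (Sum.inr j) * FreeAlgebra.ι ℂ (Sum.inr i))
  | leibniz (i : Fin 3) (p : MvPolynomial (Fin 3) ℂ) : OpRel
      (FreeAlgebra.ι ℂ (Sum.inr i) *
        FreeAlgebra.ι ℂ (Sum.inl (algebraMap (MvPolynomial (Fin 3) ℂ) RatFun p)))
      (FreeAlgebra.ι ℂ (Sum.inl (algebraMap (MvPolynomial (Fin 3) ℂ) RatFun p)) *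
          FreeAlgebra.ι ℂ (Sum.inr i) +
        FreeAlgebra.ι ℂ (Sum.inl (algebraMap (MvPolynomial (Fin 3) ℂ) RatFun
          (MvPolynomial.pderiv i p))))

/-- The (noncommutative) algebra `ℂ(z₁,z₂,z₃)⟨∂₁,∂₂,∂₃⟩` of linear partial differential operators
with rational coefficients, that is, the Weyl algebra in three variables with all nonzero
polynomials inverted. -/
abbrev DiffOp : Type := RingQuot OpRel

/-- Multiplication by a rational function, as a differential operator of order `0`. -/
noncomputable def mulOp (f : RatFun) : DiffOp :=
  RingQuot.mkAlgHom ℂ OpRel (FreeAlgebra.ι ℂ (Sum.inl f))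

/-- The partial derivative with respect to `z_{i+1}`. -/
noncomputable def pd (i : Fin 3) : DiffOp :=
  RingQuot.mkAlgHom ℂ OpRel (FreeAlgebra.ι ℂ (Sum.inr i))

/-- The Euler operator `θ = z ∂/∂z` of the variable `z_{i+1}`. -/
noncomputable def theta (i : Fin 3) : DiffOp := mulOp (z i) * pd i

/-- A system of homogeneous linear partial differential equations with rational coefficients is
given by the left ideal `I` of operators that it annihilates (`Ideal` means left ideal in a
noncommutative ring). The system is reducible if the left module `DiffOp ⧸ I` is, i.e. if it has a
submodule other than zero and the whole module: there is a left ideal strictly between `I` and the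
whole algebra. -/
def IsReducible (I : Ideal DiffOp) : Prop :=
  ∃ J : Ideal DiffOp, I < J ∧ J < ⊤

/-- The coefficient of `z₁ ^ m₁ z₂ ^ m₂ z₃ ^ m₃` in the Lauricella–Saran series
`F_N(a₁,a₂,a₃; b₁,b₂; c₁,c₂; z₁,z₂,z₃)`. -/
noncomputable def coeffFN (a₁ a₂ a₃ b₁ b₂ c₁ c₂ : ℂ) (m₁ m₂ m₃ : ℕ) : ℂ :=
  ((ascPochhammer ℂ m₁).eval a₁ * (ascPochhammer ℂ m₂).eval a₂ * (ascPochhammer ℂ m₃).eval a₃ *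
      ((ascPochhammer ℂ (m₁ + m₃)).eval b₁ * (ascPochhammer ℂ m₂).eval b₂)) /
    ((m₁.factorial : ℂ) * (m₂.factorial : ℂ) * (m₃.factorial : ℂ) *
      ((ascPochhammer ℂ m₁).eval c₁ * (ascPochhammer ℂ (m₂ + m₃)).eval c₂))

section Polynomials

variable {A : Type*} [Ring A] [Algebra ℂ A]

/-- The numerators `P_j` of the ratios `C(m + e_j) / C(m) = P_j(m) / Q_j(m)` of neighbouring
coefficients of the `F_N` series, as polynomials that can be evaluated at (pairwise commuting)
elements `t` of any `ℂ`-algebra. -/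
def P (a₁ a₂ a₃ b₁ b₂ : ℂ) (t : Fin 3 → A) : Fin 3 → A :=
  ![(t 0 + algebraMap ℂ A a₁) * (t 0 + t 2 + algebraMap ℂ A b₁),
    (t 1 + algebraMap ℂ A a₂) * (t 1 + algebraMap ℂ A b₂),
    (t 2 + algebraMap ℂ A a₃) * (t 0 + t 2 + algebraMap ℂ A b₁)]

/-- The denominators `Q_j` of the ratios `C(m + e_j) / C(m) = P_j(m) / Q_j(m)`. -/
def Q (c₁ c₂ : ℂ) (t : Fin 3 → A) : Fin 3 → A :=
  ![(t 0 + 1) * (t 0 + algebraMap ℂ A c₁),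
    (t 1 + 1) * (t 1 + t 2 + algebraMap ℂ A c₂),
    (t 2 + 1) * (t 1 + t 2 + algebraMap ℂ A c₂)]

end Polynomials

/-- `P` and `Q` are the numerators and denominators of the ratios of neighbouring coefficients of
the `F_N` series, whenever that series is defined. -/
theorem coeffFN_ratio (a₁ a₂ a₃ b₁ b₂ c₁ c₂ : ℂ) (h₁ : ∀ n : ℕ, c₁ + n ≠ 0)
    (h₂ : ∀ n : ℕ, c₂ + n ≠ 0) (m₁ m₂ m₃ : ℕ) :
    (Q c₁ c₂ ![(m₁ : ℂ), m₂, m₃] 0 * coeffFN a₁ a₂ a₃ b₁ b₂ c₁ c₂ (m₁ + 1) m₂ m₃ =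
      P a₁ a₂ a₃ b₁ b₂ ![(m₁ : ℂ), m₂, m₃] 0 * coeffFN a₁ a₂ a₃ b₁ b₂ c₁ c₂ m₁ m₂ m₃) ∧
    (Q c₁ c₂ ![(m₁ : ℂ), m₂, m₃] 1 * coeffFN a₁ a₂ a₃ b₁ b₂ c₁ c₂ m₁ (m₂ + 1) m₃ =
      P a₁ a₂ a₃ b₁ b₂ ![(m₁ : ℂ), m₂, m₃] 1 * coeffFN a₁ a₂ a₃ b₁ b₂ c₁ c₂ m₁ m₂ m₃) ∧
    (Q c₁ c₂ ![(m₁ : ℂ), m₂, m₃] 2 * coeffFN a₁ a₂ a₃ b₁ b₂ c₁ c₂ m₁ m₂ (m₃ + 1) =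
      P a₁ a₂ a₃ b₁ b₂ ![(m₁ : ℂ), m₂, m₃] 2 * coeffFN a₁ a₂ a₃ b₁ b₂ c₁ c₂ m₁ m₂ m₃) := by
  have hne : ∀ x : ℂ, (∀ n : ℕ, x + n ≠ 0) → ∀ k : ℕ, (ascPochhammer ℂ k).eval x ≠ 0 := by
    intro x hx k
    induction k with
    | zero => simp
    | succ k ih => rw [ascPochhammer_succ_eval]; exact mul_ne_zero ih (hx k)
  have f : ∀ k : ℕ, (k.factorial : ℂ) ≠ 0 := fun k => by exact_mod_cast k.factorial_ne_zero
  have s : ∀ k : ℕ, (k : ℂ) + 1 ≠ 0 := fun k => by exact_mod_cast k.succ_ne_zero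
  have e1 := hne c₁ h₁ m₁
  have e2 := hne c₂ h₂ (m₂ + m₃)
  have e3 := h₁ m₁
  have e4 := h₂ (m₂ + m₃)
  push_cast at e4
  have g1 := f m₁
  have g2 := f m₂
  have g3 := f m₃
  have s1 := s m₁
  have s2 := s m₂
  have s3 := s m₃
  have r1 : m₁ + 1 + m₃ = m₁ + m₃ + 1 := by ring
  have r2 : m₂ + 1 + m₃ = m₂ + m₃ + 1 := by ring
  have r3 : m₁ + (m₃ + 1) = m₁ + m₃ + 1 := by ring
  have r4 : m₂ + (m₃ + 1) = m₂ + m₃ + 1 := by ring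
  refine ⟨?_, ?_, ?_⟩
  · simp only [coeffFN, P, Q, r1, ascPochhammer_succ_eval, Nat.factorial_succ]
    simp
    field_simp
    ring
  · simp only [coeffFN, P, Q, r2, ascPochhammer_succ_eval, Nat.factorial_succ]
    simp
    field_simp
    ring
  · simp only [coeffFN, P, Q, r3, r4, ascPochhammer_succ_eval, Nat.factorial_succ]
    simp
    field_simp
    ring

/-- The operators `L_j = Q_j(θ) z_j⁻¹ - P_j(θ)` of the system satisfied by the `F_N` series. -/
noncomputable def opFN (a₁ a₂ a₃ b₁ b₂ c₁ c₂ : ℂ) (j : Fin 3) : DiffOp :=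
  Q c₁ c₂ theta j * mulOp (z j)⁻¹ - P a₁ a₂ a₃ b₁ b₂ theta j

/-- The system of differential equations `L₁ F = L₂ F = L₃ F = 0` defined by the `F_N` series, as
the left ideal generated by `L₁, L₂, L₃`. -/
noncomputable def systemFN (a₁ a₂ a₃ b₁ b₂ c₁ c₂ : ℂ) : Ideal DiffOp :=
  Ideal.span (Set.range (opFN a₁ a₂ a₃ b₁ b₂ c₁ c₂))

end FNSystem

/-!
Write `A = z₁ L₁`, `B = z₂ L₂`, `C = z₃ L₃`, `u = θ₁ + θ₃ + b₁`, `v = θ₂ + θ₃ + c₂ - 1`, and let `D` be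
the algebra of differential operators, `K` the field of rational functions and `I` the left ideal of
the system.

*The rank is always `8`.* The operators satisfy `[A, B] = [A, C] = 0` and `[B, C] = θ₂ C - θ₃ B`, and
their principal symbols, divisible by `θ₁`, `θ₂` and `θ₃` respectively, are three quadrics without a
common zero in the projective plane over `K`. By the first property and division by `A` and `B`,
`I` is spanned over `K` by the operators `θ^m A`, by `θ^m B` with `m₁ ≤ 1` and by `θ^m C` with
`m₁, m₂ ≤ 1`; by the second, these operators and the eight squarefree monomials in the `θ_j` span `D`.
In each order there are as many of them as there are monomials `θ^m`, which are linearly independent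
(`linearIndependent_mono`), so they form a basis (`IsIntegrableTriple.linearIndependent_adapted`).
Hence the squarefree monomials are a basis of `D / I`, for all values of the parameters
(`IsIntegrableTriple.finrank_quotient`, `IsIntegrableTriple.coeff_eq_zero`); no operator of order at
most `1` except `0` lies in `I`.

*Contiguity.* Right multiplication by `X = θ₁ + a₁` is a homomorphism from the module of the system
with `a₁ + 1` to that of the system with `a₁`. Similarly `θ₂ + a₂`, `θ₃ + a₃`, `u` and `v` belong to
the shifts of `a₂`, `a₃`, `b₁` and (downwards) `c₂`. All these homomorphisms are nonzero as `X` has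
order `1`. A nonzero homomorphism between modules of equal finite rank, one of which is simple, is
bijective; so if one of the modules in the chain of integer shifts of a parameter were simple, then
all the homomorphisms of the chain would be bijective (`isReducible_of_chain`).

*A homomorphism that is not bijective.* For `a₁ = 0` there is `Y` of order `1` with `A = Y θ₁`, so the
homomorphism `1 ↦ θ₁` is not injective; the cases of `a₂`, `a₃` and `b₁` are alike, and `b₂` is
exchanged with `a₂` by a symmetry of the system. For the other four conditions shift `c₂`: for a
suitable member of the chain there is a monomial `z^ρ` that solves the system and is killed by `v`, so
the image of `1 ↦ v` is a proper submodule (`isReducible_of_monomial_solution`).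
-/

namespace FNSystem

/-! ### Partial derivatives of rational functions and the action of operators -/

theorem algebraMap_ne_zero {p : MvPolynomial (Fin 3) ℂ} (hp : p ≠ 0) :
    algebraMap (MvPolynomial (Fin 3) ℂ) RatFun p ≠ 0 := by
  simpa using (IsFractionRing.injective (MvPolynomial (Fin 3) ℂ) RatFun).ne hp

theorem z_ne_zero (i : Fin 3) : z i ≠ 0 :=
  algebraMap_ne_zero (MvPolynomial.X_ne_zero i)

/-- The ring homomorphism `x ↦ f x + ε d x` to dual numbers attached to a map `d` that is a
derivation along the ring homomorphism `f`. -/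
def dualHomOfDerivation {S K : Type*} [CommRing S] [CommRing K] (f : S →+* K) (d : S →+ K)
    (h1 : d 1 = 0) (hd : ∀ x y, d (x * y) = f x * d y + f y * d x) : S →+* DualNumber K where
  toFun x := TrivSqZeroExt.inl (f x) + TrivSqZeroExt.inr (d x)
  map_one' := by ext <;> simp [h1]
  map_zero' := by ext <;> simp
  map_add' x y := by ext <;> simp
  map_mul' x y := by ext <;> simp [hd, mul_comm]

theorem fst_dualHomOfDerivation {S K : Type*} [CommRing S] [CommRing K] (f : S →+* K)
    (d : S →+ K) (h1 : d 1 = 0) (hd : ∀ x y, d (x * y) = f x * d y + f y * d x) (x : S) :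
    (dualHomOfDerivation f d h1 hd x).fst = f x := by
  simp [dualHomOfDerivation]

theorem snd_dualHomOfDerivation {S K : Type*} [CommRing S] [CommRing K] (f : S →+* K)
    (d : S →+ K) (h1 : d 1 = 0) (hd : ∀ x y, d (x * y) = f x * d y + f y * d x) (x : S) :
    (dualHomOfDerivation f d h1 hd x).snd = d x := by
  simp [dualHomOfDerivation]

/-- The homomorphism `p ↦ p + ε ∂p/∂zᵢ` from polynomials to dual numbers over the field of rational
functions. -/
noncomputable def dualHomPoly (i : Fin 3) : MvPolynomial (Fin 3) ℂ →+* DualNumber RatFun :=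
  dualHomOfDerivation (algebraMap _ RatFun)
    ((algebraMap (MvPolynomial (Fin 3) ℂ) RatFun).toAddMonoidHom.comp
      (MvPolynomial.pderiv (R := ℂ) i).toLinearMap.toAddMonoidHom)
    (by simp) (fun x y => by simp [Derivation.leibniz])

theorem fst_dualHomPoly (i : Fin 3) (p : MvPolynomial (Fin 3) ℂ) :
    (dualHomPoly i p).fst = algebraMap _ RatFun p :=
  fst_dualHomOfDerivation _ _ _ _ p

theorem snd_dualHomPoly (i : Fin 3) (p : MvPolynomial (Fin 3) ℂ) :
    (dualHomPoly i p).snd = algebraMap _ RatFun (MvPolynomial.pderiv i p) :=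
  snd_dualHomOfDerivation _ _ _ _ p

theorem isUnit_dualHomPoly (i : Fin 3) (p : nonZeroDivisors (MvPolynomial (Fin 3) ℂ)) :
    IsUnit (dualHomPoly i p) := by
  rw [TrivSqZeroExt.isUnit_iff_isUnit_fst, fst_dualHomPoly]
  exact (algebraMap_ne_zero (nonZeroDivisors.ne_zero p.2)).isUnit

/-- The homomorphism `f ↦ f + ε ∂f/∂zᵢ` from rational functions to dual numbers. -/
noncomputable def dualHom (i : Fin 3) : RatFun →+* DualNumber RatFun :=
  IsLocalization.lift (isUnit_dualHomPoly i)

theorem dualHom_algebraMap (i : Fin 3) (p : MvPolynomial (Fin 3) ℂ) :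
    dualHom i (algebraMap _ RatFun p) = dualHomPoly i p :=
  IsLocalization.lift_eq (isUnit_dualHomPoly i) p

theorem fst_dualHom (i : Fin 3) (f : RatFun) : (dualHom i f).fst = f := by
  have h : ((TrivSqZeroExt.fstHom RatFun RatFun RatFun).toRingHom.comp (dualHom i)) =
      RingHom.id RatFun := by
    apply IsLocalization.ringHom_ext (nonZeroDivisors (MvPolynomial (Fin 3) ℂ))
    ext p : 1
    · ext r
      simp [dualHom_algebraMap, fst_dualHomPoly]
    · simp [dualHom_algebraMap, fst_dualHomPoly]
  exact congrArg (fun g : RatFun →+* RatFun => g f) h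

/-- The partial derivative `∂/∂zᵢ` on rational functions. -/
noncomputable def pderivRat (i : Fin 3) : Derivation ℂ RatFun RatFun :=
  Derivation.mk'
    { toFun := fun f => (dualHom i f).snd
      map_add' := fun f g => by simp
      map_smul' := fun r f => by
        have h : algebraMap ℂ RatFun r =
            algebraMap (MvPolynomial (Fin 3) ℂ) RatFun (MvPolynomial.C r) := rfl
        rw [Algebra.smul_def, map_mul, TrivSqZeroExt.snd_mul, h, dualHom_algebraMap,
          fst_dualHomPoly, snd_dualHomPoly, ← h]
        simp [Algebra.smul_def] }
    fun f g => by
      change (dualHom i (f * g)).snd = _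
      rw [map_mul, TrivSqZeroExt.snd_mul]
      simp [fst_dualHom, mul_comm]

theorem pderivRat_algebraMap (i : Fin 3) (p : MvPolynomial (Fin 3) ℂ) :
    pderivRat i (algebraMap _ RatFun p) = algebraMap _ RatFun (MvPolynomial.pderiv i p) := by
  change (dualHom i _).snd = _
  rw [dualHom_algebraMap, snd_dualHomPoly]

theorem pderivRat_z (i j : Fin 3) : pderivRat i (z j) = if i = j then 1 else 0 := by
  rw [z, pderivRat_algebraMap, MvPolynomial.pderiv_X]
  by_cases h : i = j
  · subst h; simp
  · simp [h, Ne.symm h]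

/-- A derivation of the field of rational functions is determined by its values on polynomials. -/
theorem derivation_ext {d e : Derivation ℂ RatFun RatFun}
    (h : ∀ p : MvPolynomial (Fin 3) ℂ, d (algebraMap _ RatFun p) = e (algebraMap _ RatFun p)) :
    d = e := by
  ext f
  obtain ⟨p, q, hq, rfl⟩ := IsFractionRing.div_surjective (A := MvPolynomial (Fin 3) ℂ) f
  have hq' := algebraMap_ne_zero (nonZeroDivisors.ne_zero hq)
  set x := algebraMap _ RatFun p / algebraMap _ RatFun q with hx
  have hxq : algebraMap _ RatFun q * x = algebraMap _ RatFun p := by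
    rw [hx]; field_simp
  have h1 := h p
  rw [← hxq, Derivation.leibniz, Derivation.leibniz, h q] at h1
  simpa [hq'] using h1

theorem pderiv_comm (i j : Fin 3) (p : MvPolynomial (Fin 3) ℂ) :
    MvPolynomial.pderiv i (MvPolynomial.pderiv j p) =
      MvPolynomial.pderiv j (MvPolynomial.pderiv i p) := by
  have h : ⁅MvPolynomial.pderiv (R := ℂ) i, MvPolynomial.pderiv (R := ℂ) j⁆ = 0 := by
    apply MvPolynomial.derivation_ext
    intro k
    rw [Derivation.commutator_apply, MvPolynomial.pderiv_X, MvPolynomial.pderiv_X]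
    simp only [Pi.single_apply]
    split_ifs <;> simp
  have := congrArg (fun d : Derivation ℂ (MvPolynomial (Fin 3) ℂ) (MvPolynomial (Fin 3) ℂ) => d p) h
  simpa [Derivation.commutator_apply, sub_eq_zero] using this

theorem pderivRat_comm (i j : Fin 3) (f : RatFun) :
    pderivRat i (pderivRat j f) = pderivRat j (pderivRat i f) := by
  have h : ⁅pderivRat i, pderivRat j⁆ = 0 := by
    apply derivation_ext
    intro p
    rw [Derivation.commutator_apply]
    simp only [pderivRat_algebraMap, Derivation.coe_zero, Pi.zero_apply]
    rw [pderiv_comm, sub_self]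
  have := congrArg (fun d : Derivation ℂ RatFun RatFun => d f) h
  simpa [Derivation.commutator_apply, sub_eq_zero] using this

/-- The derivation `∂/∂zᵢ` twisted by the exponent vector `ρ`: the operator
`∂/∂zᵢ + ρᵢ / zᵢ`, which is the conjugate of `∂/∂zᵢ` by the monomial `z^ρ`. -/
noncomputable def twistedDeriv (ρ : Fin 3 → ℂ) (i : Fin 3) : Module.End ℂ RatFun :=
  (pderivRat i : RatFun →ₗ[ℂ] RatFun) + LinearMap.mulLeft ℂ (ρ i • (z i)⁻¹)

theorem twistedDeriv_apply (ρ : Fin 3 → ℂ) (i : Fin 3) (f : RatFun) :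
    twistedDeriv ρ i f = pderivRat i f + ρ i • (z i)⁻¹ * f := rfl

theorem twistedDeriv_mul (ρ : Fin 3 → ℂ) (i : Fin 3) (f g : RatFun) :
    twistedDeriv ρ i (f * g) = f * twistedDeriv ρ i g + pderivRat i f * g := by
  simp only [twistedDeriv_apply, Derivation.leibniz, smul_eq_mul]
  ring

theorem twistedDeriv_comm (ρ : Fin 3 → ℂ) (i j : Fin 3) (f : RatFun) :
    twistedDeriv ρ i (twistedDeriv ρ j f) = twistedDeriv ρ j (twistedDeriv ρ i f) := by
  by_cases h : i = j
  · rw [h]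
  have h' : j ≠ i := Ne.symm h
  have e : ∀ a b : Fin 3, a ≠ b → pderivRat a ((z b)⁻¹) = 0 := by
    intro a b hab
    rw [Derivation.leibniz_inv, pderivRat_z]
    simp [hab]
  simp only [twistedDeriv_apply, map_add, Derivation.leibniz, smul_eq_mul, Derivation.map_smul,
    e i j h, e j i h', pderivRat_comm i j f]
  simp only [smul_zero, mul_zero, add_zero]
  ring

/-- The action of differential operators on the twisted module `z^ρ ℂ(z₁,z₂,z₃)`, where an element
`z^ρ f` is represented by `f`. -/
noncomputable def twistedRep (ρ : Fin 3 → ℂ) : DiffOp →ₐ[ℂ] Module.End ℂ RatFun :=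
  RingQuot.liftAlgHom ℂ
    ⟨FreeAlgebra.lift ℂ (Sum.elim (fun f => LinearMap.mulLeft ℂ f) (twistedDeriv ρ)), by
      intro x y hxy
      induction hxy with
      | add f g => ext h; simp [add_mul]
      | mul f g => ext h; simp
      | const r => ext h; simp [Algebra.smul_def]
      | comm i j => ext h; simpa using twistedDeriv_comm ρ i j h
      | leibniz i p =>
        ext h
        simpa [pderivRat_algebraMap] using twistedDeriv_mul ρ i (algebraMap _ RatFun p) h⟩

theorem twistedRep_mulOp (ρ : Fin 3 → ℂ) (f g : RatFun) : twistedRep ρ (mulOp f) g = f * g := by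
  simp [twistedRep, mulOp]

theorem twistedRep_pd (ρ : Fin 3 → ℂ) (i : Fin 3) (g : RatFun) :
    twistedRep ρ (pd i) g = twistedDeriv ρ i g := by
  simp [twistedRep, pd]

theorem twistedRep_theta_one (ρ : Fin 3 → ℂ) (i : Fin 3) :
    twistedRep ρ (theta i) 1 = algebraMap ℂ RatFun (ρ i) := by
  rw [theta, map_mul, Module.End.mul_apply, twistedRep_pd, twistedRep_mulOp, twistedDeriv_apply]
  have := z_ne_zero i
  simp [Algebra.smul_def]
  field_simp

/-- The result of applying a differential operator to the monomial `z^ρ`, divided by `z^ρ`. -/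
noncomputable def symbolAt (ρ : Fin 3 → ℂ) (x : DiffOp) : RatFun := twistedRep ρ x 1

theorem symbolAt_add (ρ : Fin 3 → ℂ) (x y : DiffOp) :
    symbolAt ρ (x + y) = symbolAt ρ x + symbolAt ρ y := by simp [symbolAt]

theorem symbolAt_mulOp_mul (ρ : Fin 3 → ℂ) (f : RatFun) (x : DiffOp) :
    symbolAt ρ (mulOp f * x) = f * symbolAt ρ x := by
  simp [symbolAt, twistedRep_mulOp]

theorem symbolAt_mul_theta (ρ : Fin 3 → ℂ) (x : DiffOp) (i : Fin 3) :
    symbolAt ρ (x * theta i) = algebraMap ℂ RatFun (ρ i) * symbolAt ρ x := by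
  rw [symbolAt, map_mul, Module.End.mul_apply, twistedRep_theta_one, Algebra.algebraMap_eq_smul_one,
    map_smul, Algebra.smul_def, symbolAt, Algebra.smul_def, mul_one]

/-! ### The algebra of operators as a vector space over the rational functions -/

/-- Rational functions as differential operators of order `0`. -/
noncomputable def mulOpHom : RatFun →+* DiffOp where
  toFun := mulOp
  map_one' := by
    have h := RingQuot.mkAlgHom_rel ℂ (OpRel.const 1)
    simpa [mulOp] using h
  map_zero' := by
    have h := RingQuot.mkAlgHom_rel ℂ (OpRel.const 0)
    simpa [mulOp] using h
  map_add' f g := by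
    have h := RingQuot.mkAlgHom_rel ℂ (OpRel.add f g)
    simpa [mulOp] using h
  map_mul' f g := by
    have h := RingQuot.mkAlgHom_rel ℂ (OpRel.mul f g)
    simpa [mulOp] using h

theorem mulOp_zero : mulOp 0 = 0 := map_zero mulOpHom
theorem mulOp_one : mulOp 1 = 1 := map_one mulOpHom
theorem mulOp_add (f g : RatFun) : mulOp (f + g) = mulOp f + mulOp g := map_add mulOpHom f g
theorem mulOp_sub (f g : RatFun) : mulOp (f - g) = mulOp f - mulOp g := map_sub mulOpHom f g
theorem mulOp_mul (f g : RatFun) : mulOp (f * g) = mulOp f * mulOp g := map_mul mulOpHom f g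

theorem mulOp_algebraMap (r : ℂ) : mulOp (algebraMap ℂ RatFun r) = algebraMap ℂ DiffOp r := by
  have h := RingQuot.mkAlgHom_rel ℂ (OpRel.const r)
  simpa [mulOp] using h

theorem mulOp_comm (f g : RatFun) : mulOp f * mulOp g = mulOp g * mulOp f := by
  rw [← mulOp_mul, mul_comm, mulOp_mul]

theorem pd_comm (i j : Fin 3) : pd i * pd j = pd j * pd i := by
  have h := RingQuot.mkAlgHom_rel ℂ (OpRel.comm i j)
  simpa [pd] using h

theorem pd_mulOp_algebraMap (i : Fin 3) (p : MvPolynomial (Fin 3) ℂ) :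
    pd i * mulOp (algebraMap _ RatFun p) = mulOp (algebraMap _ RatFun p) * pd i +
      mulOp (algebraMap _ RatFun (MvPolynomial.pderiv i p)) := by
  have h := RingQuot.mkAlgHom_rel ℂ (OpRel.leibniz i p)
  simpa [pd, mulOp] using h

/-- The Leibniz rule for rational functions. -/
theorem pd_mulOp (i : Fin 3) (f : RatFun) :
    pd i * mulOp f = mulOp f * pd i + mulOp (pderivRat i f) := by
  obtain ⟨p, q, hq, hf⟩ := IsFractionRing.div_surjective (A := MvPolynomial (Fin 3) ℂ) f
  have hq' := algebraMap_ne_zero (nonZeroDivisors.ne_zero hq)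
  set Q := algebraMap _ RatFun q with hQ
  have hp : algebraMap _ RatFun p = Q * f := by rw [← hf]; field_simp
  have h1 := pd_mulOp_algebraMap i p
  rw [← pderivRat_algebraMap, hp, Derivation.leibniz, mulOp_add, smul_eq_mul, smul_eq_mul,
    mulOp_mul, mulOp_mul, mulOp_mul, ← mul_assoc, pd_mulOp_algebraMap i q, ← hQ,
    ← pderivRat_algebraMap, ← hQ, mulOp_comm f, add_mul, mul_assoc, ← add_assoc] at h1
  have h2 := add_right_cancel h1
  rw [mul_assoc, ← mul_add] at h2
  have h3 := congrArg (fun x => mulOp Q⁻¹ * x) h2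
  simpa only [← mul_assoc, ← mulOp_mul, inv_mul_cancel₀ hq', mulOp_one, one_mul] using h3

theorem theta_mulOp (i : Fin 3) (f : RatFun) :
    theta i * mulOp f = mulOp f * theta i + mulOp (z i * pderivRat i f) := by
  rw [theta, mul_assoc, pd_mulOp, mul_add, mulOp_mul, ← mul_assoc, ← mul_assoc, mulOp_comm]

theorem theta_comm (i j : Fin 3) : theta i * theta j = theta j * theta i := by
  by_cases h : i = j
  · rw [h]
  have e : ∀ a b : Fin 3, a ≠ b → pd a * mulOp (z b) = mulOp (z b) * pd a := by
    intro a b hab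
    rw [pd_mulOp, pderivRat_z, if_neg hab, mulOp_zero, add_zero]
  rw [theta, theta, mul_assoc, ← mul_assoc (pd i), e i j h, mul_assoc, ← mul_assoc, mulOp_comm,
    pd_comm, mul_assoc (mulOp (z j)) (pd j), ← mul_assoc (pd j), e j i (Ne.symm h)]
  simp only [mul_assoc]

/-- Rational functions act on differential operators by multiplication from the left. -/
noncomputable instance : Module RatFun DiffOp := Module.compHom DiffOp mulOpHom

theorem smul_eq_mulOp_mul (f : RatFun) (x : DiffOp) : f • x = mulOp f * x := rfl

instance : IsScalarTower RatFun DiffOp DiffOp :=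
  ⟨fun f x y => by simp only [smul_eq_mulOp_mul, smul_eq_mul, mul_assoc]⟩

instance : IsScalarTower ℂ RatFun DiffOp :=
  ⟨fun r f x => by
    rw [smul_eq_mulOp_mul, smul_eq_mulOp_mul, Algebra.smul_def, mulOp_mul, mulOp_algebraMap,
      mul_assoc, Algebra.smul_def]⟩

theorem theta_mul_smul (i : Fin 3) (f : RatFun) (x : DiffOp) :
    theta i * (f • x) = f • (theta i * x) + (z i * pderivRat i f) • x := by
  simp only [smul_eq_mulOp_mul, ← mul_assoc, theta_mulOp, add_mul]

/-! ### Monomials in the Euler operators and the order filtration -/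

/-- The monomial `θ₁^i θ₂^j θ₃^k`. -/
noncomputable def mono (i j k : ℕ) : DiffOp := theta 0 ^ i * theta 1 ^ j * theta 2 ^ k

theorem mono_mul_mono (i j k i' j' k' : ℕ) :
    mono i j k * mono i' j' k' = mono (i + i') (j + j') (k + k') := by
  have c (a b : Fin 3) (m n : ℕ) : Commute (theta a ^ m) (theta b ^ n) :=
    Commute.pow_pow (theta_comm a b) m n
  simp only [mono, pow_add]
  rw [mul_assoc, ← mul_assoc (theta 2 ^ k), ((c 2 0 k i').mul_right (c 2 1 k j')).eq,
    mul_assoc (theta 0 ^ i), ← mul_assoc (theta 1 ^ j), ← mul_assoc (theta 1 ^ j),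
    ← mul_assoc (theta 1 ^ j), (c 1 0 j i').eq]
  simp only [mul_assoc]

theorem theta_zero_eq : theta 0 = mono 1 0 0 := by simp [mono]
theorem theta_one_eq : theta 1 = mono 0 1 0 := by simp [mono]
theorem theta_two_eq : theta 2 = mono 0 0 1 := by simp [mono]
theorem one_eq_mono : (1 : DiffOp) = mono 0 0 0 := by simp [mono]

theorem symbolAt_mono (ρ : Fin 3 → ℂ) (i j k : ℕ) :
    symbolAt ρ (mono i j k) = algebraMap ℂ RatFun (ρ 0 ^ i * ρ 1 ^ j * ρ 2 ^ k) := by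
  have h (x : DiffOp) (l : Fin 3) (n : ℕ) :
      symbolAt ρ (x * theta l ^ n) = algebraMap ℂ RatFun (ρ l ^ n) * symbolAt ρ x := by
    induction n with
    | zero => simp
    | succ n ih => rw [pow_succ, ← mul_assoc, symbolAt_mul_theta, ih, pow_succ, map_mul]; ring
  have h1 : symbolAt ρ 1 = 1 := by simp [symbolAt]
  rw [mono, h, h, ← one_mul (theta 0 ^ i), h, h1]
  simp only [map_mul]
  ring

/-- The values of an operator at all monomials `z^ρ` with complex exponents. -/
noncomputable def symbolMap : DiffOp →ₗ[RatFun] ((Fin 3 → ℂ) → RatFun) where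
  toFun x ρ := symbolAt ρ x
  map_add' x y := by ext ρ; exact symbolAt_add ρ x y
  map_smul' f x := by ext ρ; exact symbolAt_mulOp_mul ρ f x

/-- The character `ρ ↦ ρ^m` of the multiplicative monoid `ℂ³`. -/
noncomputable def powCharacter (m : ℕ × ℕ × ℕ) : (Fin 3 → ℂ) →* RatFun where
  toFun ρ := algebraMap ℂ RatFun (ρ 0 ^ m.1 * ρ 1 ^ m.2.1 * ρ 2 ^ m.2.2)
  map_one' := by simp
  map_mul' ρ σ := by
    rw [← map_mul]
    congr 1
    simp only [Pi.mul_apply, mul_pow]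
    ring

theorem powCharacter_injective : Function.Injective powCharacter := by
  intro m n h
  have key (ρ : Fin 3 → ℂ) : ρ 0 ^ m.1 * ρ 1 ^ m.2.1 * ρ 2 ^ m.2.2 =
      ρ 0 ^ n.1 * ρ 1 ^ n.2.1 * ρ 2 ^ n.2.2 :=
    (algebraMap ℂ RatFun).injective (congrArg (fun c : (Fin 3 → ℂ) →* RatFun => c ρ) h)
  have two (a b : ℕ) (hab : (2 : ℂ) ^ a = 2 ^ b) : a = b :=
    Nat.pow_right_injective (le_refl 2) (by exact_mod_cast hab)
  have h0 := key ![2, 1, 1]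
  have h1 := key ![1, 2, 1]
  have h2 := key ![1, 1, 2]
  simp at h0 h1 h2
  exact Prod.ext (two _ _ h0) (Prod.ext (two _ _ h1) (two _ _ h2))

/-- The Poincaré–Birkhoff–Witt property: the monomials in the Euler operators are linearly
independent over the rational functions. An operator that vanishes takes the value `0` at all the
monomials `z^ρ`, and `ρ ↦ ρ^m` are distinct characters of a monoid. -/
theorem linearIndependent_mono :
    LinearIndependent RatFun (fun m : ℕ × ℕ × ℕ => mono m.1 m.2.1 m.2.2) := by
  apply LinearIndependent.of_comp symbolMap
  have h := (linearIndependent_monoidHom (Fin 3 → ℂ) RatFun).comp powCharacter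
    powCharacter_injective
  have e : symbolMap ∘ (fun m : ℕ × ℕ × ℕ => mono m.1 m.2.1 m.2.2) =
      (fun c : (Fin 3 → ℂ) →* RatFun => (c : (Fin 3 → ℂ) → RatFun)) ∘ powCharacter := by
    ext m ρ
    exact symbolAt_mono ρ _ _ _
  rw [e]
  exact h

/-- The operators of order less than `n`. -/
noncomputable def ordLT (n : ℕ) : Submodule RatFun DiffOp :=
  Submodule.span RatFun {x | ∃ i j k, i + j + k < n ∧ x = mono i j k}

theorem mono_mem_ordLT {i j k n : ℕ} (h : i + j + k < n) : mono i j k ∈ ordLT n :=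
  Submodule.subset_span ⟨i, j, k, h, rfl⟩

theorem ordLT_mono {m n : ℕ} (h : m ≤ n) : ordLT m ≤ ordLT n := by
  apply Submodule.span_mono
  rintro x ⟨i, j, k, hx, rfl⟩
  exact ⟨i, j, k, by omega, rfl⟩

theorem theta_mem_ordLT (i : Fin 3) : theta i ∈ ordLT 2 := by
  fin_cases i
  · change theta 0 ∈ _; rw [theta_zero_eq]; exact mono_mem_ordLT (by omega)
  · change theta 1 ∈ _; rw [theta_one_eq]; exact mono_mem_ordLT (by omega)
  · change theta 2 ∈ _; rw [theta_two_eq]; exact mono_mem_ordLT (by omega)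

theorem one_mem_ordLT : (1 : DiffOp) ∈ ordLT 1 := by
  rw [one_eq_mono]; exact mono_mem_ordLT (by omega)

theorem theta_mul_mono_mem (l : Fin 3) (i j k : ℕ) :
    theta l * mono i j k ∈ ordLT (i + j + k + 2) := by
  fin_cases l
  · change theta 0 * _ ∈ _
    rw [theta_zero_eq, mono_mul_mono]; exact mono_mem_ordLT (by omega)
  · change theta 1 * _ ∈ _
    rw [theta_one_eq, mono_mul_mono]; exact mono_mem_ordLT (by omega)
  · change theta 2 * _ ∈ _
    rw [theta_two_eq, mono_mul_mono]; exact mono_mem_ordLT (by omega)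

theorem theta_mul_mem (l : Fin 3) {n : ℕ} {x : DiffOp} (hx : x ∈ ordLT n) :
    theta l * x ∈ ordLT (n + 1) := by
  induction hx using Submodule.span_induction with
  | mem x hx =>
    obtain ⟨i, j, k, h, rfl⟩ := hx
    exact ordLT_mono (by omega) (theta_mul_mono_mem l i j k)
  | zero => rw [mul_zero]; exact zero_mem _
  | add x y _ _ hx hy => rw [mul_add]; exact add_mem hx hy
  | smul f x hx' hx =>
    rw [theta_mul_smul]
    exact add_mem (Submodule.smul_mem _ _ hx)
      (Submodule.smul_mem _ _ (ordLT_mono (Nat.le_succ n) hx'))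

theorem theta_pow_mul_mem (l : Fin 3) (r : ℕ) {n : ℕ} {x : DiffOp} (hx : x ∈ ordLT n) :
    theta l ^ r * x ∈ ordLT (n + r) := by
  induction r with
  | zero => simpa using hx
  | succ r ih => rw [pow_succ', mul_assoc]; exact theta_mul_mem l ih

theorem mul_mem_ordLT {m n : ℕ} {x y : DiffOp} (hx : x ∈ ordLT (m + 1)) (hy : y ∈ ordLT n) :
    x * y ∈ ordLT (m + n) := by
  induction hx using Submodule.span_induction with
  | mem x hx =>
    obtain ⟨i, j, k, h, rfl⟩ := hx
    rw [mono, mul_assoc, mul_assoc]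
    exact ordLT_mono (by omega)
      (theta_pow_mul_mem 0 i (theta_pow_mul_mem 1 j (theta_pow_mul_mem 2 k hy)))
  | zero => rw [zero_mul]; exact zero_mem _
  | add x y _ _ hx hy => rw [add_mul]; exact add_mem hx hy
  | smul f x _ hx => rw [smul_mul_assoc]; exact Submodule.smul_mem _ _ hx

/-- Every differential operator has finite order. -/
theorem exists_mem_ordLT (x : DiffOp) : ∃ n, x ∈ ordLT n := by
  have hf (f : RatFun) : mulOp f ∈ ordLT 1 := by
    rw [← mul_one (mulOp f), ← smul_eq_mulOp_mul]
    exact Submodule.smul_mem _ _ one_mem_ordLT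
  obtain ⟨w, rfl⟩ := RingQuot.mkAlgHom_surjective ℂ OpRel x
  induction w using FreeAlgebra.induction with
  | grade0 r =>
    refine ⟨1, ?_⟩
    rw [AlgHom.commutes, ← mulOp_algebraMap]
    exact hf _
  | grade1 s =>
    rcases s with f | i
    · exact ⟨1, hf f⟩
    · refine ⟨2, ?_⟩
      change pd i ∈ _
      have h : pd i = (z i)⁻¹ • theta i := by
        rw [smul_eq_mulOp_mul, theta, ← mul_assoc, ← mulOp_mul, inv_mul_cancel₀ (z_ne_zero i),
          mulOp_one, one_mul]
      rw [h]
      exact Submodule.smul_mem _ _ (theta_mem_ordLT i)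
  | mul a b ha hb =>
    obtain ⟨m, hm⟩ := ha
    obtain ⟨n, hn⟩ := hb
    rw [map_mul]
    exact ⟨m + n, mul_mem_ordLT (ordLT_mono (Nat.le_succ m) hm) hn⟩
  | add a b ha hb =>
    obtain ⟨m, hm⟩ := ha
    obtain ⟨n, hn⟩ := hb
    rw [map_add]
    exact ⟨m + n, add_mem (ordLT_mono (by omega) hm) (ordLT_mono (by omega) hn)⟩

/-- Commuting an operator of order at most `n` with a rational function lowers the order. -/
theorem mul_mulOp_sub_mem {n : ℕ} {x : DiffOp} (hx : x ∈ ordLT (n + 1)) (f : RatFun) :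
    x * mulOp f - f • x ∈ ordLT n := by
  have hpow (l : Fin 3) (r : ℕ) {m : ℕ} {y : DiffOp} (hy : y ∈ ordLT (m + 1))
      (h : y * mulOp f - f • y ∈ ordLT m) :
      (theta l ^ r * y) * mulOp f - f • (theta l ^ r * y) ∈ ordLT (m + r) := by
    induction r with
    | zero => simpa using h
    | succ r ih =>
      have hy' := theta_pow_mul_mem l r hy
      rw [pow_succ', mul_assoc (theta l)]
      set w := theta l ^ r * y
      have e : theta l * w * mulOp f - f • (theta l * w) =
          theta l * (w * mulOp f - f • w) + (z l * pderivRat l f) • w := by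
        rw [mul_sub, theta_mul_smul, mul_assoc]
        abel
      rw [e]
      exact add_mem (theta_mul_mem l ih)
        (Submodule.smul_mem _ _ (ordLT_mono (by omega) hy'))
  induction hx using Submodule.span_induction with
  | mem x hx =>
    obtain ⟨i, j, k, h, rfl⟩ := hx
    have h0 : (1 : DiffOp) * mulOp f - f • 1 ∈ ordLT 0 := by
      rw [smul_eq_mulOp_mul, one_mul, mul_one, sub_self]; exact zero_mem _
    have h1 := hpow 2 k one_mem_ordLT h0
    have m1 := theta_pow_mul_mem 2 k one_mem_ordLT
    have h2 := hpow 1 j (m := 0 + k) (by simpa [add_comm] using m1) h1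
    have m2 := theta_pow_mul_mem 1 j m1
    have h3 := hpow 0 i (m := 0 + k + j) (ordLT_mono (by omega) m2) h2
    rw [mul_one, ← mul_assoc] at h3
    exact ordLT_mono (by omega) h3
  | zero => simp
  | add x y _ _ hx hy =>
    rw [add_mul, smul_add, add_sub_add_comm]; exact add_mem hx hy
  | smul g x _ hx =>
    rw [smul_mul_assoc, smul_comm f g, ← smul_sub]; exact Submodule.smul_mem _ _ hx

/-! ### Systems whose principal symbols form a complete intersection -/

section Elimination

variable {K M : Type*} [Field K] [AddCommGroup M] [Module K M] {P : Submodule K M}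
  {p₀ p₁ p₂ z₀ z₂ : K} {x y w : M}

theorem mem_of_relations (h : p₀ * p₁ * p₂ - p₀ - z₀ * z₂ * p₁ ≠ 0)
    (hC : p₂ • x + y - z₂ • w ∈ P) (hB : p₁ • y + x ∈ P) (hA : p₀ • w - z₀ • x ∈ P) : x ∈ P := by
  refine (Submodule.smul_mem_iff P h).1 ?_
  convert add_mem (sub_mem (P.smul_mem (p₀ * p₁) hC) (P.smul_mem p₀ hB))
    (P.smul_mem (z₂ * p₁) hA) using 1
  module

theorem mem_of_relations_left (h : p₀ * p₂ - z₀ * z₂ ≠ 0)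
    (hC : p₂ • x + y - z₂ • w ∈ P) (hy : y ∈ P) (hA : p₀ • w - z₀ • x ∈ P) : x ∈ P := by
  refine (Submodule.smul_mem_iff P h).1 ?_
  convert add_mem (sub_mem (P.smul_mem p₀ hC) (P.smul_mem p₀ hy)) (P.smul_mem z₂ hA) using 1
  module

theorem mem_of_relations_middle (h : p₁ * p₂ - 1 ≠ 0)
    (hC : p₂ • x + y - z₂ • w ∈ P) (hB : p₁ • y + x ∈ P) (hw : w ∈ P) : x ∈ P := by
  refine (Submodule.smul_mem_iff P h).1 ?_
  convert sub_mem (add_mem (P.smul_mem p₁ hC) (P.smul_mem (z₂ * p₁) hw)) hB using 1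
  module

theorem mem_of_relations_right (h : p₂ ≠ 0)
    (hC : p₂ • x + y - z₂ • w ∈ P) (hy : y ∈ P) (hw : w ∈ P) : x ∈ P := by
  refine (Submodule.smul_mem_iff P h).1 ?_
  convert add_mem (sub_mem hC hy) (P.smul_mem z₂ hw) using 1
  module

end Elimination

/-- Three operators of order `2` with the principal symbols of the operators `z_j L_j` of the `F_N`
system, and with commutators in which every term has order less than the product of the
operators. -/
structure IsIntegrableTriple (A B C : DiffOp) : Prop where
  symbol_A : A - ((1 - z 0) • mono 2 0 0 - z 0 • mono 1 0 1) ∈ ordLT 2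
  symbol_B : B - ((1 - z 1) • mono 0 2 0 + mono 0 1 1) ∈ ordLT 2
  symbol_C : C - ((1 - z 2) • mono 0 0 2 + mono 0 1 1 - z 2 • mono 1 0 1) ∈ ordLT 2
  comm_AB : A * B = B * A
  comm_AC : A * C = C * A
  comm_BC : B * C = C * B + theta 1 * C - theta 2 * B

theorem mul_mem_ordLT' {m n : ℕ} {x y : DiffOp} (hx : x ∈ ordLT m) (hy : y ∈ ordLT (n + 1)) :
    x * y ∈ ordLT (m + n) := by
  cases m with
  | zero =>
    have h0 : x = 0 := by
      have e : {x : DiffOp | ∃ i j k, i + j + k < 0 ∧ x = mono i j k} = ∅ := by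
        ext x; simp
      simpa [ordLT] using hx
    rw [h0, zero_mul]; exact zero_mem _
  | succ m => exact ordLT_mono (by omega) (mul_mem_ordLT hx hy)

/-- Multiplication of monomials is commutative up to terms of lower order. -/
theorem mono_mul_smul_mono (a b c i j k : ℕ) (f : RatFun) :
    mono a b c * (f • mono i j k) - f • mono (a + i) (b + j) (c + k) ∈
      ordLT (a + b + c + (i + j + k)) := by
  have h := mul_mulOp_sub_mem (mono_mem_ordLT (Nat.lt_succ_self (a + b + c))) f
  have h' := mul_mem_ordLT' h (mono_mem_ordLT (Nat.lt_succ_self (i + j + k)))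
  rw [sub_mul, smul_mul_assoc, mono_mul_mono, mul_assoc] at h'
  exact h'

/-- Right multiplication by an operator, as a map of vector spaces over the rational functions. -/
noncomputable def rightMul (y : DiffOp) : DiffOp →ₗ[RatFun] DiffOp where
  toFun x := x * y
  map_add' x x' := add_mul x x' y
  map_smul' f x := smul_mul_assoc f x y

theorem rightMul_apply (x y : DiffOp) : rightMul y x = x * y := rfl

/-- The adapted family: the monomial `θ^m` with one factor `θ₁²`, `θ₂²` or `θ₃²`, the first that
is available, replaced by the operator `A`, `B` or `C`. -/
noncomputable def adapted (A B C : DiffOp) (i j k : ℕ) : DiffOp :=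
  if 2 ≤ i then mono (i - 2) j k * A
  else if 2 ≤ j then mono i (j - 2) k * B
  else if 2 ≤ k then mono i j (k - 2) * C
  else mono i j k

/-- The span of the members of degree less than `n` of the adapted family that are not squarefree
monomials. -/
noncomputable def adaptedLT (A B C : DiffOp) (n : ℕ) : Submodule RatFun DiffOp :=
  Submodule.span RatFun
    {x | ∃ i j k, i + j + k < n ∧ (2 ≤ i ∨ 2 ≤ j ∨ 2 ≤ k) ∧ x = adapted A B C i j k}

theorem adaptedLT_mono (A B C : DiffOp) {m n : ℕ} (h : m ≤ n) :
    adaptedLT A B C m ≤ adaptedLT A B C n := by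
  apply Submodule.span_mono
  rintro x ⟨i, j, k, hx, hs, rfl⟩
  exact ⟨i, j, k, by omega, hs, rfl⟩

theorem adapted_mem (A B C : DiffOp) {i j k n : ℕ} (h : i + j + k < n)
    (hs : 2 ≤ i ∨ 2 ≤ j ∨ 2 ≤ k) : adapted A B C i j k ∈ adaptedLT A B C n :=
  Submodule.subset_span ⟨i, j, k, h, hs, rfl⟩

theorem algebraMap_ne_zero_of_eval {p : MvPolynomial (Fin 3) ℂ} (v : Fin 3 → ℂ)
    (h : MvPolynomial.eval v p ≠ 0) : algebraMap (MvPolynomial (Fin 3) ℂ) RatFun p ≠ 0 :=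
  algebraMap_ne_zero fun h0 => h (by rw [h0, map_zero])

theorem one_sub_z_ne_zero (i : Fin 3) : 1 - z i ≠ 0 := by
  have := algebraMap_ne_zero_of_eval (p := 1 - MvPolynomial.X i) 0 (by simp)
  simpa [z] using this

theorem singular_ne_zero₀₂ : (1 - z 0) * (1 - z 2) - z 0 * z 2 ≠ 0 := by
  have := algebraMap_ne_zero_of_eval (p := (1 - .X 0) * (1 - .X 2) - .X 0 * .X 2) 0 (by simp)
  simpa [z] using this

theorem singular_ne_zero₁₂ : (1 - z 1) * (1 - z 2) - 1 ≠ 0 := by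
  have := algebraMap_ne_zero_of_eval (p := (1 - .X 1) * (1 - .X 2) - 1) 1 (by simp)
  simpa [z] using this

theorem singular_ne_zero :
    (1 - z 0) * (1 - z 1) * (1 - z 2) - (1 - z 0) - z 0 * z 2 * (1 - z 1) ≠ 0 := by
  have := algebraMap_ne_zero_of_eval
    (p := (1 - .X 0) * (1 - .X 1) * (1 - .X 2) - (1 - .X 0) - .X 0 * .X 2 * (1 - .X 1))
    ![0, 1, 1] (by simp)
  simpa [z] using this


namespace IsIntegrableTriple

variable {A B C : DiffOp}

theorem mem_A (H : IsIntegrableTriple A B C) : A ∈ ordLT 3 := by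
  have h := add_mem (ordLT_mono (by omega : 2 ≤ 3) H.symbol_A)
    (sub_mem (Submodule.smul_mem _ (1 - z 0) (mono_mem_ordLT (by omega : 2 + 0 + 0 < 3)))
      (Submodule.smul_mem _ (z 0) (mono_mem_ordLT (by omega : 1 + 0 + 1 < 3))))
  rwa [sub_add_cancel] at h

theorem mem_B (H : IsIntegrableTriple A B C) : B ∈ ordLT 3 := by
  have h := add_mem (ordLT_mono (by omega : 2 ≤ 3) H.symbol_B)
    (add_mem (Submodule.smul_mem _ (1 - z 1) (mono_mem_ordLT (by omega : 0 + 2 + 0 < 3)))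
      (mono_mem_ordLT (by omega : 0 + 1 + 1 < 3)))
  rwa [sub_add_cancel] at h

theorem mem_C (H : IsIntegrableTriple A B C) : C ∈ ordLT 3 := by
  have h := add_mem (ordLT_mono (by omega : 2 ≤ 3) H.symbol_C)
    (sub_mem (add_mem
      (Submodule.smul_mem _ (1 - z 2) (mono_mem_ordLT (by omega : 0 + 0 + 2 < 3)))
      (mono_mem_ordLT (by omega : 0 + 1 + 1 < 3)))
      (Submodule.smul_mem _ (z 2) (mono_mem_ordLT (by omega : 1 + 0 + 1 < 3))))
  rwa [sub_add_cancel] at h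

theorem mono_mul_mem {n : ℕ} {x : DiffOp} (hx : x ∈ ordLT 3) {a b c : ℕ} (h : a + b + c + 2 = n) :
    mono a b c * x ∈ ordLT (n + 1) :=
  ordLT_mono (by omega) (mul_mem_ordLT (mono_mem_ordLT (Nat.lt_succ_self (a + b + c))) hx)

/-- The symbol of `θ^m A`. -/
theorem symbol_mono_mul_A (H : IsIntegrableTriple A B C) {s a b c : ℕ} (h : a + b + c + 2 = s) :
    mono a b c * A - ((1 - z 0) • mono (a + 2) b c - z 0 • mono (a + 1) b (c + 1)) ∈ ordLT s := by
  have h1 := mul_mem_ordLT (mono_mem_ordLT (Nat.lt_succ_self (a + b + c))) H.symbol_A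
  have h2 := mono_mul_smul_mono a b c 2 0 0 (1 - z 0)
  have h3 := mono_mul_smul_mono a b c 1 0 1 (z 0)
  rw [mul_sub, mul_sub] at h1
  subst h
  convert add_mem h1 (sub_mem h2 h3) using 1
  simp only [add_zero]
  abel

/-- The symbol of `θ^m B`. -/
theorem symbol_mono_mul_B (H : IsIntegrableTriple A B C) {s a b c : ℕ} (h : a + b + c + 2 = s) :
    mono a b c * B - ((1 - z 1) • mono a (b + 2) c + mono a (b + 1) (c + 1)) ∈ ordLT s := by
  have h1 := mul_mem_ordLT (mono_mem_ordLT (Nat.lt_succ_self (a + b + c))) H.symbol_B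
  have h2 := mono_mul_smul_mono a b c 0 2 0 (1 - z 1)
  rw [mul_sub, mul_add, mono_mul_mono] at h1
  subst h
  convert add_mem h1 h2 using 1
  simp only [add_zero]
  abel

/-- The symbol of `θ^m C`. -/
theorem symbol_mono_mul_C (H : IsIntegrableTriple A B C) {s a b c : ℕ} (h : a + b + c + 2 = s) :
    mono a b c * C - ((1 - z 2) • mono a b (c + 2) + mono a (b + 1) (c + 1) -
      z 2 • mono (a + 1) b (c + 1)) ∈ ordLT s := by
  have h1 := mul_mem_ordLT (mono_mem_ordLT (Nat.lt_succ_self (a + b + c))) H.symbol_C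
  have h2 := mono_mul_smul_mono a b c 0 0 2 (1 - z 2)
  have h3 := mono_mul_smul_mono a b c 1 0 1 (z 2)
  rw [mul_sub, mul_sub, mul_add, mono_mul_mono] at h1
  subst h
  convert add_mem h1 (sub_mem h2 h3) using 1
  simp only [add_zero]
  abel

variable {P : Submodule RatFun DiffOp} {s : ℕ}

/-- A relation between symbols, obtained by subtracting lower order terms. -/
theorem mem_of_sub_mem (hlow : ordLT s ≤ P) {x y : DiffOp} (hx : x ∈ P) (h : x - y ∈ ordLT s) :
    y ∈ P := by
  have := sub_mem hx (hlow h)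
  rwa [sub_sub_cancel] at this

/-- Division by `A`: monomials of degree `s` are reduced to those of degree at most `1` in `θ₁`. -/
theorem mono_mem_of_le_one_left (H : IsIntegrableTriple A B C) (hlow : ordLT s ≤ P)
    (hA : ∀ a b c, a + b + c + 2 = s → mono a b c * A ∈ P)
    (h1 : ∀ i j k, i ≤ 1 → i + j + k = s → mono i j k ∈ P) :
    ∀ i j k, i + j + k = s → mono i j k ∈ P := by
  intro i
  induction i with
  | zero => exact fun j k h => h1 0 j k (by omega) h
  | succ i ih =>
    cases i with
    | zero => exact fun j k h => h1 1 j k le_rfl h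
    | succ a =>
      intro j k h
      have e := mem_of_sub_mem hlow (hA a j k (by omega)) (H.symbol_mono_mul_A (by omega))
      have e' := add_mem e (Submodule.smul_mem _ (z 0) (ih j (k + 1) (by omega)))
      rw [sub_add_cancel] at e'
      exact (Submodule.smul_mem_iff _ (one_sub_z_ne_zero 0)).1 e'

/-- Division by `B`: monomials of degree `s` are reduced to those of degree at most `1` in `θ₂`. -/
theorem mono_mem_of_le_one_middle (H : IsIntegrableTriple A B C) (hlow : ordLT s ≤ P)
    (hB : ∀ a b c, a + b + c + 2 = s → mono a b c * B ∈ P) (i : ℕ)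
    (h1 : ∀ j k, j ≤ 1 → i + j + k = s → mono i j k ∈ P) :
    ∀ j k, i + j + k = s → mono i j k ∈ P := by
  intro j
  induction j with
  | zero => exact fun k h => h1 0 k (by omega) h
  | succ j ih =>
    cases j with
    | zero => exact fun k h => h1 1 k le_rfl h
    | succ b =>
      intro k h
      have e := mem_of_sub_mem hlow (hB i b k (by omega)) (H.symbol_mono_mul_B (by omega))
      have e' := sub_mem e (ih (k + 1) (by omega))
      rw [add_sub_cancel_right] at e'
      exact (Submodule.smul_mem_iff _ (one_sub_z_ne_zero 1)).1 e'

theorem mul_A_mem {n : ℕ} {x : DiffOp} (hx : x ∈ ordLT n) :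
    x * A ∈ adaptedLT A B C (n + 2) := by
  have h : ordLT n ≤ (adaptedLT A B C (n + 2)).comap (rightMul A) := by
    refine Submodule.span_le.2 ?_
    rintro _ ⟨i, j, k, h, rfl⟩
    have := adapted_mem A B C (i := i + 2) (j := j) (k := k) (n := n + 2) (by omega) (by omega)
    simpa [adapted, rightMul_apply] using this
  exact h hx

/-- Operators `X B` lie in the span of the adapted family: a multiple of `A` in `X` can be moved
past `B`. -/
theorem mul_B_mem (H : IsIntegrableTriple A B C) {n : ℕ} {x : DiffOp} (hx : x ∈ ordLT n) :
    x * B ∈ adaptedLT A B C (n + 2) := by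
  suffices h : ∀ n, ordLT n ≤ (adaptedLT A B C (n + 2)).comap (rightMul B) from h n hx
  clear hx x n
  intro n
  induction n with
  | zero => exact Submodule.span_le.2 fun x ⟨i, j, k, h, _⟩ => absurd h (by omega)
  | succ n ih =>
    have ih' : ordLT n ≤ (adaptedLT A B C (n + 1 + 2)).comap (rightMul B) :=
      ih.trans (Submodule.comap_mono (adaptedLT_mono A B C (by omega)))
    refine Submodule.span_le.2 ?_
    rintro _ ⟨i, j, k, h, rfl⟩
    rcases Nat.lt_succ_iff_lt_or_eq.1 h with h | h
    · exact ih' (mono_mem_ordLT h)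
    · refine H.mono_mem_of_le_one_left ih' ?_ ?_ i j k h
      · intro a b c hs
        rw [Submodule.mem_comap, rightMul_apply, mul_assoc, H.comm_AB, ← mul_assoc]
        exact mul_A_mem (mono_mul_mem H.mem_B hs)
      · intro i j k hi hs
        have := adapted_mem A B C (i := i) (j := j + 2) (k := k) (n := n + 1 + 2) (by omega)
          (by omega)
        simpa [adapted, rightMul_apply, Nat.not_le.2 (Nat.lt_succ_of_le hi)] using this

/-- Operators `X C` lie in the span of the adapted family: multiples of `A` and `B` in `X` can be
moved past `C`, up to operators `Y B` and `Y C` with `Y` of lower order. -/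
theorem mul_C_mem (H : IsIntegrableTriple A B C) {n : ℕ} {x : DiffOp} (hx : x ∈ ordLT n) :
    x * C ∈ adaptedLT A B C (n + 2) := by
  suffices h : ∀ n, ordLT n ≤ (adaptedLT A B C (n + 2)).comap (rightMul C) from h n hx
  clear hx x n
  intro n
  induction n with
  | zero => exact Submodule.span_le.2 fun x ⟨i, j, k, h, _⟩ => absurd h (by omega)
  | succ n ih =>
    have ih' : ordLT n ≤ (adaptedLT A B C (n + 1 + 2)).comap (rightMul C) :=
      ih.trans (Submodule.comap_mono (adaptedLT_mono A B C (by omega)))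
    refine Submodule.span_le.2 ?_
    rintro _ ⟨i, j, k, h, rfl⟩
    rcases Nat.lt_succ_iff_lt_or_eq.1 h with h | h
    · exact ih' (mono_mem_ordLT h)
    · refine H.mono_mem_of_le_one_left ih' ?_ ?_ i j k h
      · intro a b c hs
        rw [Submodule.mem_comap, rightMul_apply, mul_assoc, H.comm_AC, ← mul_assoc]
        exact mul_A_mem (mono_mul_mem H.mem_C hs)
      · intro i j k hi hs
        refine H.mono_mem_of_le_one_middle ih' ?_ i ?_ j k hs
        · intro a b c hs
          rw [Submodule.mem_comap, rightMul_apply, mul_assoc, H.comm_BC, mul_sub, mul_add,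
            ← mul_assoc, ← mul_assoc, ← mul_assoc, theta_one_eq, theta_two_eq, mono_mul_mono,
            mono_mul_mono]
          refine sub_mem (add_mem ?_ ?_) ?_
          · exact H.mul_B_mem (mono_mul_mem H.mem_C hs)
          · exact ih' (mono_mem_ordLT (by omega))
          · exact H.mul_B_mem (mono_mem_ordLT (by omega))
        · intro j k hj hs
          have := adapted_mem A B C (i := i) (j := j) (k := k + 2) (n := n + 1 + 2) (by omega)
            (by omega)
          simpa [adapted, rightMul_apply, Nat.not_le.2 (Nat.lt_succ_of_le hi),
            Nat.not_le.2 (Nat.lt_succ_of_le hj)] using this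

/-- The symbols of `A`, `B`, `C` are a complete intersection: modulo their multiples and terms of
lower order, every monomial is a combination of squarefree ones. -/
theorem mono_mem_of_squarefree (H : IsIntegrableTriple A B C) (hlow : ordLT s ≤ P)
    (hA : ∀ a b c, a + b + c + 2 = s → mono a b c * A ∈ P)
    (hB : ∀ a b c, a + b + c + 2 = s → mono a b c * B ∈ P)
    (hC : ∀ a b c, a + b + c + 2 = s → mono a b c * C ∈ P)
    (hsq : ∀ i j k, i ≤ 1 → j ≤ 1 → k ≤ 1 → i + j + k = s → mono i j k ∈ P) :
    ∀ i j k, i + j + k = s → mono i j k ∈ P := by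
  have rA {a b c : ℕ} (h : a + b + c + 2 = s) :=
    mem_of_sub_mem hlow (hA a b c h) (H.symbol_mono_mul_A h)
  have rB {a b c : ℕ} (h : a + b + c + 2 = s) :=
    mem_of_sub_mem hlow (hB a b c h) (H.symbol_mono_mul_B h)
  have rC {a b c : ℕ} (h : a + b + c + 2 = s) :=
    mem_of_sub_mem hlow (hC a b c h) (H.symbol_mono_mul_C h)
  have h11 (k : ℕ) (hs : 1 + 1 + k = s) : mono 1 1 k ∈ P := by
    rcases k with _ | _ | k
    · exact hsq _ _ _ (by omega) (by omega) (by omega) hs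
    · exact hsq _ _ _ (by omega) (by omega) (by omega) hs
    · exact mem_of_relations singular_ne_zero (rC (a := 1) (b := 1) (c := k) (by omega))
        (rB (a := 1) (b := 0) (c := k + 1) (by omega))
        (rA (a := 0) (b := 1) (c := k + 1) (by omega))
  have h10 (k : ℕ) (hs : 1 + 0 + k = s) : mono 1 0 k ∈ P := by
    rcases k with _ | _ | k
    · exact hsq _ _ _ (by omega) (by omega) (by omega) hs
    · exact hsq _ _ _ (by omega) (by omega) (by omega) hs
    · exact mem_of_relations_left singular_ne_zero₀₂ (rC (a := 1) (b := 0) (c := k) (by omega))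
        (h11 (k + 1) (by omega)) (rA (a := 0) (b := 0) (c := k + 1) (by omega))
  have h01 (k : ℕ) (hs : 0 + 1 + k = s) : mono 0 1 k ∈ P := by
    rcases k with _ | _ | k
    · exact hsq _ _ _ (by omega) (by omega) (by omega) hs
    · exact hsq _ _ _ (by omega) (by omega) (by omega) hs
    · exact mem_of_relations_middle singular_ne_zero₁₂ (rC (a := 0) (b := 1) (c := k) (by omega))
        (rB (a := 0) (b := 0) (c := k + 1) (by omega)) (h11 (k + 1) (by omega))
  have h00 (k : ℕ) (hs : 0 + 0 + k = s) : mono 0 0 k ∈ P := by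
    rcases k with _ | _ | k
    · exact hsq _ _ _ (by omega) (by omega) (by omega) hs
    · exact hsq _ _ _ (by omega) (by omega) (by omega) hs
    · exact mem_of_relations_right (one_sub_z_ne_zero 2)
        (rC (a := 0) (b := 0) (c := k) (by omega)) (h01 (k + 1) (by omega))
        (h10 (k + 1) (by omega))
  refine H.mono_mem_of_le_one_left hlow hA fun i j k hi => ?_
  refine H.mono_mem_of_le_one_middle hlow hB i (fun j k hj => ?_) j k
  interval_cases i <;> interval_cases j
  exacts [h00 k, h01 k, h10 k, h11 k]

/-- The adapted family spans. -/
theorem ordLT_le_span_adapted (H : IsIntegrableTriple A B C) (n : ℕ) :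
    ordLT n ≤ Submodule.span RatFun {x | ∃ i j k, i + j + k < n ∧ x = adapted A B C i j k} := by
  have hle (n : ℕ) : adaptedLT A B C n ≤
      Submodule.span RatFun {x | ∃ i j k, i + j + k < n ∧ x = adapted A B C i j k} := by
    apply Submodule.span_mono
    rintro x ⟨i, j, k, h, _, rfl⟩
    exact ⟨i, j, k, h, rfl⟩
  induction n with
  | zero => exact Submodule.span_le.2 fun x ⟨i, j, k, h, _⟩ => absurd h (by omega)
  | succ n ih =>
    have ih' := ih.trans (Submodule.span_mono (R := RatFun)
      (t := {x | ∃ i j k, i + j + k < n + 1 ∧ x = adapted A B C i j k}) (by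
        rintro x ⟨i, j, k, h, rfl⟩
        exact ⟨i, j, k, by omega, rfl⟩))
    refine Submodule.span_le.2 ?_
    rintro _ ⟨i, j, k, h, rfl⟩
    rcases Nat.lt_succ_iff_lt_or_eq.1 h with h | h
    · exact ih' (mono_mem_ordLT h)
    · refine H.mono_mem_of_squarefree ih' ?_ ?_ ?_ ?_ i j k h
      · intro a b c hs
        refine hle _ (adaptedLT_mono A B C ?_ (mul_A_mem (mono_mem_ordLT (Nat.lt_succ_self _))))
        omega
      · intro a b c hs
        refine hle _ (adaptedLT_mono A B C ?_ (H.mul_B_mem (mono_mem_ordLT (Nat.lt_succ_self _))))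
        omega
      · intro a b c hs
        refine hle _ (adaptedLT_mono A B C ?_ (H.mul_C_mem (mono_mem_ordLT (Nat.lt_succ_self _))))
        omega
      · intro i j k hi hj hk hs
        refine Submodule.subset_span ⟨i, j, k, by omega, ?_⟩
        rw [adapted, if_neg (by omega), if_neg (by omega), if_neg (by omega)]

theorem adapted_mem_ordLT (H : IsIntegrableTriple A B C) {i j k n : ℕ} (h : i + j + k < n) :
    adapted A B C i j k ∈ ordLT n := by
  rw [adapted]
  split_ifs with hi hj hk
  · exact ordLT_mono (by omega) (mono_mul_mem H.mem_A rfl)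
  · exact ordLT_mono (by omega) (mono_mul_mem H.mem_B rfl)
  · exact ordLT_mono (by omega) (mono_mul_mem H.mem_C rfl)
  · exact mono_mem_ordLT h

/-- The adapted family is linearly independent: in every degree it spans a space whose dimension,
known from the monomials, is the number of its members. -/
theorem linearIndependent_adapted (H : IsIntegrableTriple A B C) :
    LinearIndependent RatFun (fun m : ℕ × ℕ × ℕ => adapted A B C m.1 m.2.1 m.2.2) := by
  have key (n : ℕ) : LinearIndependent RatFun
      (fun m : {m : ℕ × ℕ × ℕ // m.1 + m.2.1 + m.2.2 < n} =>
        adapted A B C m.1.1 m.1.2.1 m.1.2.2) := by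
    have hfin : Finite {m : ℕ × ℕ × ℕ // m.1 + m.2.1 + m.2.2 < n} := by
      refine Set.Finite.subset (((Set.finite_lt_nat n).prod
        ((Set.finite_lt_nat n).prod (Set.finite_lt_nat n)))) ?_
      rintro ⟨i, j, k⟩ h
      have h' : i + j + k < n := h
      exact ⟨(by omega : i < n), (by omega : j < n), (by omega : k < n)⟩
    have := Fintype.ofFinite {m : ℕ × ℕ × ℕ // m.1 + m.2.1 + m.2.2 < n}
    have hr (f : ℕ → ℕ → ℕ → DiffOp) :
        Set.range (fun m : {m : ℕ × ℕ × ℕ // m.1 + m.2.1 + m.2.2 < n} => f m.1.1 m.1.2.1 m.1.2.2) =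
          {x | ∃ i j k, i + j + k < n ∧ x = f i j k} := by
      ext x
      constructor
      · rintro ⟨⟨⟨i, j, k⟩, h⟩, rfl⟩
        exact ⟨i, j, k, h, rfl⟩
      · rintro ⟨i, j, k, h, rfl⟩
        exact ⟨⟨⟨i, j, k⟩, h⟩, rfl⟩
    have hmono := linearIndependent_mono.comp _
      (Subtype.val_injective (p := fun m : ℕ × ℕ × ℕ => m.1 + m.2.1 + m.2.2 < n))
    rw [linearIndependent_iff_card_eq_finrank_span] at hmono ⊢
    rw [hmono]
    change Set.finrank RatFun (Set.range (fun m : {m : ℕ × ℕ × ℕ // m.1 + m.2.1 + m.2.2 < n} =>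
      mono m.1.1 m.1.2.1 m.1.2.2)) = _
    rw [hr mono, hr (adapted A B C), Set.finrank, Set.finrank]
    have e : Submodule.span RatFun {x | ∃ i j k, i + j + k < n ∧ x = mono i j k} =
        Submodule.span RatFun {x | ∃ i j k, i + j + k < n ∧ x = adapted A B C i j k} := by
      refine le_antisymm (H.ordLT_le_span_adapted n) (Submodule.span_le.2 ?_)
      rintro _ ⟨i, j, k, h, rfl⟩
      exact H.adapted_mem_ordLT h
    rw [e]
  rw [linearIndependent_iff_finset_linearIndependent]
  intro t
  obtain ⟨n, hn⟩ : ∃ n, ∀ m ∈ t, m.1 + m.2.1 + m.2.2 < n :=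
    ⟨t.sup (fun m => m.1 + m.2.1 + m.2.2) + 1, fun m hm =>
      Nat.lt_succ_of_le (Finset.le_sup (f := fun m : ℕ × ℕ × ℕ => m.1 + m.2.1 + m.2.2) hm)⟩
  exact (key n).comp (fun m : t => ⟨m.1, hn m.1 m.2⟩) fun a b hab =>
    Subtype.ext (congrArg (fun x => x.1) hab)

end IsIntegrableTriple

namespace IsIntegrableTriple

variable {A B C : DiffOp}

/-- The left ideal generated by an integrable triple is spanned by the members of the adapted family
that are not squarefree monomials. -/
theorem restrictScalars_span (H : IsIntegrableTriple A B C) :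
    (Ideal.span {A, B, C}).restrictScalars RatFun = Submodule.span RatFun
      ((fun m : ℕ × ℕ × ℕ => adapted A B C m.1 m.2.1 m.2.2) ''
        {m | 2 ≤ m.1 ∨ 2 ≤ m.2.1 ∨ 2 ≤ m.2.2}) := by
  apply le_antisymm
  · have hle (n : ℕ) : adaptedLT A B C n ≤ Submodule.span RatFun
        ((fun m : ℕ × ℕ × ℕ => adapted A B C m.1 m.2.1 m.2.2) ''
          {m | 2 ≤ m.1 ∨ 2 ≤ m.2.1 ∨ 2 ≤ m.2.2}) := by
      apply Submodule.span_mono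
      rintro x ⟨i, j, k, _, hs, rfl⟩
      exact ⟨(i, j, k), hs, rfl⟩
    intro x hx
    rw [Submodule.restrictScalars_mem, Ideal.span, Submodule.mem_span_triple] at hx
    obtain ⟨a, b, c, rfl⟩ := hx
    obtain ⟨na, ha⟩ := exists_mem_ordLT a
    obtain ⟨nb, hb⟩ := exists_mem_ordLT b
    obtain ⟨nc, hc⟩ := exists_mem_ordLT c
    exact add_mem (add_mem (hle _ (mul_A_mem ha)) (hle _ (H.mul_B_mem hb)))
      (hle _ (H.mul_C_mem hc))
  · refine Submodule.span_le.2 ?_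
    rintro _ ⟨⟨i, j, k⟩, hs, rfl⟩
    change adapted A B C i j k ∈ Ideal.span {A, B, C}
    rw [adapted]
    split_ifs with hi hj hk
    · exact Ideal.mul_mem_left _ _ (Ideal.subset_span (by simp))
    · exact Ideal.mul_mem_left _ _ (Ideal.subset_span (by simp))
    · exact Ideal.mul_mem_left _ _ (Ideal.subset_span (by simp))
    · exact absurd hs (by simp [hi, hj, hk])

/-- The squarefree monomials in the Euler operators span a complement of the left ideal generated
by an integrable triple. -/
theorem isCompl_span_squarefree (H : IsIntegrableTriple A B C) :
    IsCompl ((Ideal.span {A, B, C}).restrictScalars RatFun) (Submodule.span RatFun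
      ((fun m : ℕ × ℕ × ℕ => adapted A B C m.1 m.2.1 m.2.2) ''
        {m | 2 ≤ m.1 ∨ 2 ≤ m.2.1 ∨ 2 ≤ m.2.2}ᶜ)) := by
  rw [H.restrictScalars_span]
  constructor
  · exact H.linearIndependent_adapted.disjoint_span_image disjoint_compl_right
  · rw [codisjoint_iff, ← Submodule.span_union, ← Set.image_union, Set.union_compl_self,
      Set.image_univ, eq_top_iff]
    intro x _
    obtain ⟨n, hn⟩ := exists_mem_ordLT x
    refine Submodule.span_mono ?_ (H.ordLT_le_span_adapted n hn)
    rintro _ ⟨i, j, k, _, rfl⟩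
    exact ⟨(i, j, k), rfl⟩

theorem compl_eq : ({m | 2 ≤ m.1 ∨ 2 ≤ m.2.1 ∨ 2 ≤ m.2.2}ᶜ : Set (ℕ × ℕ × ℕ)) =
    ((Finset.range 2 ×ˢ Finset.range 2 ×ˢ Finset.range 2 : Finset (ℕ × ℕ × ℕ)) :
      Set (ℕ × ℕ × ℕ)) := by
  ext ⟨i, j, k⟩
  simp

/-- The system of differential equations given by an integrable triple has rank `8`. -/
theorem finrank_quotient (H : IsIntegrableTriple A B C) :
    Module.finrank RatFun (DiffOp ⧸ Ideal.span {A, B, C}) = 8 := by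
  have e := Submodule.quotientEquivOfIsCompl _ _ H.isCompl_span_squarefree
  have h1 := (Submodule.Quotient.restrictScalarsEquiv RatFun (Ideal.span {A, B, C})).finrank_eq
  rw [← h1, e.finrank_eq]
  have hli := H.linearIndependent_adapted.comp
    (Subtype.val : (Finset.range 2 ×ˢ Finset.range 2 ×ˢ Finset.range 2 : Finset (ℕ × ℕ × ℕ)) → _)
    Subtype.val_injective
  have h2 := finrank_span_eq_card hli
  rw [compl_eq, Set.image_eq_range]
  refine h2.trans ?_
  simp

/-- A combination of squarefree monomials that lies in the left ideal of an integrable triple is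
zero. -/
theorem coeff_eq_zero (H : IsIntegrableTriple A B C) (f : Fin 2 → Fin 2 → Fin 2 → RatFun)
    (hf : ∑ i, ∑ j, ∑ k, f i j k • mono i j k ∈ Ideal.span {A, B, C}) (i j k : Fin 2) :
    f i j k = 0 := by
  have hmono (i j k : Fin 2) : mono i j k = adapted A B C i j k := by
    rw [adapted, if_neg (by omega), if_neg (by omega), if_neg (by omega)]
  have hmem : ∑ i, ∑ j, ∑ k, f i j k • mono i j k ∈ Submodule.span RatFun
      ((fun m : ℕ × ℕ × ℕ => adapted A B C m.1 m.2.1 m.2.2) ''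
        {m | 2 ≤ m.1 ∨ 2 ≤ m.2.1 ∨ 2 ≤ m.2.2}ᶜ) := by
    refine Submodule.sum_mem _ fun i _ => Submodule.sum_mem _ fun j _ =>
      Submodule.sum_mem _ fun k _ => Submodule.smul_mem _ _ (Submodule.subset_span ?_)
    refine ⟨((i : ℕ), (j : ℕ), (k : ℕ)), ?_, (hmono i j k).symm⟩
    rw [compl_eq]
    simpa using ⟨by omega, by omega, by omega⟩
  have h0 := Submodule.disjoint_def.1 H.isCompl_span_squarefree.disjoint _ hf hmem
  have hli := linearIndependent_mono.comp
    (fun m : Fin 2 × Fin 2 × Fin 2 => ((m.1 : ℕ), (m.2.1 : ℕ), (m.2.2 : ℕ))) (by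
      rintro ⟨i, j, k⟩ ⟨i', j', k'⟩ h
      simp only [Prod.mk.injEq, Fin.val_inj] at h
      simp only [Prod.mk.injEq]
      exact h)
  refine Fintype.linearIndependent_iff.1 hli (fun m => f m.1 m.2.1 m.2.2) ?_ (i, j, k)
  rw [← h0]
  simp only [Fintype.sum_prod_type]
  rfl

end IsIntegrableTriple

/-! ### Irreducibility along a chain of systems of equal rank -/

/-- The homomorphism `D/I' → D/I` given by right multiplication by an operator `X` with
`I' X ⊆ I`. It is dual to the map `F ↦ X F` from the solutions of `I` to those of `I'`. -/
noncomputable def contiguityMap {I' I : Ideal DiffOp} (X : DiffOp) (h : ∀ y ∈ I', y * X ∈ I) :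
    (DiffOp ⧸ I') →ₗ[DiffOp] (DiffOp ⧸ I) :=
  Submodule.mapQ I' I (LinearMap.toSpanSingleton DiffOp DiffOp X) h

theorem contiguityMap_mk {I' I : Ideal DiffOp} (X : DiffOp) (h : ∀ y ∈ I', y * X ∈ I)
    (y : DiffOp) : contiguityMap X h (Submodule.Quotient.mk y) = Submodule.Quotient.mk (y * X) :=
  rfl

theorem contiguityMap_ne_zero {I' I : Ideal DiffOp} {X : DiffOp} (h : ∀ y ∈ I', y * X ∈ I)
    (hX : X ∉ I) : contiguityMap X h ≠ 0 := by
  intro h0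
  have h1 := contiguityMap_mk X h 1
  rw [h0, LinearMap.zero_apply, one_mul, eq_comm, Submodule.Quotient.mk_eq_zero] at h1
  exact hX h1

/-- A map between modules of the same finite rank over the rational functions is injective if and
only if it is surjective. -/
theorem injective_iff_surjective {I' I : Ideal DiffOp} {n : ℕ} (hn : 0 < n)
    (h' : Module.finrank RatFun (DiffOp ⧸ I') = n) (h : Module.finrank RatFun (DiffOp ⧸ I) = n)
    (f : (DiffOp ⧸ I') →ₗ[DiffOp] (DiffOp ⧸ I)) :
    Function.Injective f ↔ Function.Surjective f := by
  have := Module.finite_of_finrank_pos (h'.symm ▸ hn)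
  have := Module.finite_of_finrank_pos (h.symm ▸ hn)
  exact LinearMap.injective_iff_surjective_of_finrank_eq_finrank (f := f.restrictScalars RatFun)
    (h'.trans h.symm)

theorem bijective_of_isSimpleModule {I' I : Ideal DiffOp} {n : ℕ} (hn : 0 < n)
    (h' : Module.finrank RatFun (DiffOp ⧸ I') = n) (h : Module.finrank RatFun (DiffOp ⧸ I) = n)
    {f : (DiffOp ⧸ I') →ₗ[DiffOp] (DiffOp ⧸ I)} (hf : f ≠ 0)
    (hs : IsSimpleModule DiffOp (DiffOp ⧸ I') ∨ IsSimpleModule DiffOp (DiffOp ⧸ I)) :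
    Function.Bijective f := by
  have e := injective_iff_surjective hn h' h f
  rcases hs with hs | hs
  · have hi := LinearMap.injective_of_ne_zero hf
    exact ⟨hi, e.1 hi⟩
  · have hs := LinearMap.surjective_of_ne_zero hf
    exact ⟨e.2 hs, hs⟩

theorem isReducible_of_not_isSimpleModule {I : Ideal DiffOp} (hI : I ≠ ⊤)
    (h : ¬ IsSimpleModule DiffOp (DiffOp ⧸ I)) : IsReducible I := by
  rw [isSimpleModule_iff_isCoatom, IsCoatom] at h
  push Not at h
  obtain ⟨J, hJ, hJ'⟩ := h hI
  exact ⟨J, hJ, lt_top_iff_ne_top.2 hJ'⟩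

/-- In a chain of systems of the same rank connected by nonzero homomorphisms, an irreducible
system would make all the homomorphisms bijective. Hence if one homomorphism of the chain is not
bijective, all systems are reducible. -/
theorem isReducible_of_chain {n : ℕ} (hn : 0 < n) (I : ℤ → Ideal DiffOp)
    (hrank : ∀ t, Module.finrank RatFun (DiffOp ⧸ I t) = n) (X : ℤ → DiffOp)
    (hX : ∀ t, ∀ y ∈ I (t + 1), y * X t ∈ I t) (hne : ∀ t, X t ∉ I t)
    (h0 : ¬ Function.Bijective (contiguityMap (X 0) (hX 0))) (t : ℤ) : IsReducible (I t) := by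
  have hbij (t : ℤ) := bijective_of_isSimpleModule hn (hrank (t + 1)) (hrank t)
    (contiguityMap_ne_zero (hX t) (hne t))
  have hiff (t : ℤ) : IsSimpleModule DiffOp (DiffOp ⧸ I (t + 1)) ↔
      IsSimpleModule DiffOp (DiffOp ⧸ I t) :=
    ⟨fun hs => (LinearEquiv.ofBijective _ (hbij t (.inl hs))).isSimpleModule_iff.1 hs,
      fun hs => (LinearEquiv.ofBijective _ (hbij t (.inr hs))).isSimpleModule_iff.2 hs⟩
  have hall (t : ℤ) : ¬ IsSimpleModule DiffOp (DiffOp ⧸ I t) := by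
    induction t with
    | zero => exact fun hs => h0 (hbij 0 (.inr hs))
    | succ i ih => exact fun hs => ih ((hiff i).1 hs)
    | pred i ih =>
      intro hs
      have hs' := (hiff (-(i : ℤ) - 1)).2 hs
      rw [sub_add_cancel] at hs'
      exact ih hs'
  refine isReducible_of_not_isSimpleModule (fun htop => ?_) (hall t)
  have h1 := hrank t
  rw [htop, Module.finrank_zero_of_subsingleton] at h1
  exact hn.ne h1

theorem not_bijective_of_mul_mem {I' I : Ideal DiffOp} {X : DiffOp} (h : ∀ y ∈ I', y * X ∈ I)
    {Y : DiffOp} (hY : Y ∉ I') (hYX : Y * X ∈ I) :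
    ¬ Function.Bijective (contiguityMap X h) := by
  intro hb
  refine hY ((Submodule.Quotient.mk_eq_zero I').1 (hb.1 ?_))
  rw [contiguityMap_mk, map_zero, Submodule.Quotient.mk_eq_zero]
  exact hYX

/-- A contiguity map `1 ↦ X` is not surjective if `z^ρ` is a solution of the system which is killed
by `X`. -/
theorem not_bijective_of_symbolAt {I' I : Ideal DiffOp} {X : DiffOp} (h : ∀ y ∈ I', y * X ∈ I)
    (ρ : Fin 3 → ℂ) (hI : ∀ y ∈ I, symbolAt ρ y = 0) (hX : symbolAt ρ X = 0) :
    ¬ Function.Bijective (contiguityMap X h) := by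
  intro hb
  obtain ⟨w, hw⟩ := hb.2 (Submodule.Quotient.mk 1)
  obtain ⟨y, rfl⟩ := Submodule.Quotient.mk_surjective _ w
  rw [contiguityMap_mk, Submodule.Quotient.eq] at hw
  have h1 := hI _ hw
  have h2 : symbolAt ρ (y * X) = 0 := by
    rw [symbolAt, map_mul, Module.End.mul_apply]
    rw [symbolAt] at hX
    rw [hX, map_zero]
  have h3 : symbolAt ρ (y * X - 1) = symbolAt ρ (y * X) - 1 := by simp [symbolAt]
  rw [h3, h2] at h1
  simp at h1

/-! ### The operators of the system in normal form -/

/-- The factor `θ₁ + θ₃ + b₁`. -/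
noncomputable def opU (b₁ : ℂ) : DiffOp := theta 0 + theta 2 + b₁ • 1

/-- The factor `θ₂ + θ₃ + c₂ - 1`. -/
noncomputable def opV (c₂ : ℂ) : DiffOp := theta 1 + theta 2 + (c₂ - 1) • 1

/-- The operator `z₁ L₁`. -/
noncomputable def opA (a₁ b₁ c₁ : ℂ) : DiffOp :=
  theta 0 * (theta 0 + (c₁ - 1) • 1) - mulOp (z 0) * ((theta 0 + a₁ • 1) * opU b₁)

/-- The operator `z₂ L₂`. -/
noncomputable def opB (a₂ b₂ c₂ : ℂ) : DiffOp :=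
  theta 1 * opV c₂ - mulOp (z 1) * ((theta 1 + a₂ • 1) * (theta 1 + b₂ • 1))

/-- The operator `z₃ L₃`. -/
noncomputable def opC (a₃ b₁ c₂ : ℂ) : DiffOp :=
  theta 2 * opV c₂ - mulOp (z 2) * ((theta 2 + a₃ • 1) * opU b₁)

/-- Moving a variable to the left of an Euler operator. -/
theorem theta_mul_z_mul (i j : Fin 3) (y : DiffOp) : theta i * (mulOp (z j) * y) =
    mulOp (z j) * (theta i * y) + if i = j then mulOp (z j) * y else 0 := by
  rw [← mul_assoc, theta_mulOp, pderivRat_z, add_mul, mul_assoc]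
  split_ifs with h
  · rw [h, mul_one]
  · rw [mul_zero, mulOp_zero, zero_mul]

theorem theta_mul_theta_mul (i j : Fin 3) (y : DiffOp) :
    theta i * (theta j * y) = theta j * (theta i * y) := by
  rw [← mul_assoc, theta_comm, mul_assoc]

theorem z_mul_z_mul (i j : Fin 3) (y : DiffOp) :
    mulOp (z i) * (mulOp (z j) * y) = mulOp (z j) * (mulOp (z i) * y) := by
  rw [← mul_assoc, mulOp_comm, mul_assoc]

theorem eq_of_mul_right {x x' : DiffOp} (h : ∀ y, x * y = x' * y) : x = x' := by
  simpa using h 1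

section NormalOrdering

-- The identities below are proved by moving the variables to the left and sorting the Euler
-- operators, after which both sides are combinations of the same words; each of them needs only
-- some of the rewriting rules.
set_option linter.unusedSimpArgs false

set_option maxHeartbeats 800000 in
/-- The operators `z_j L_j` commute up to terms of lower order that are again multiples of them. -/
theorem op_commutators (a₁ a₂ a₃ b₁ b₂ c₁ c₂ : ℂ) :
    opA a₁ b₁ c₁ * opB a₂ b₂ c₂ = opB a₂ b₂ c₂ * opA a₁ b₁ c₁ ∧
    opA a₁ b₁ c₁ * opC a₃ b₁ c₂ = opC a₃ b₁ c₂ * opA a₁ b₁ c₁ ∧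
    opB a₂ b₂ c₂ * opC a₃ b₁ c₂ =
      opC a₃ b₁ c₂ * opB a₂ b₂ c₂ + theta 1 * opC a₃ b₁ c₂ - theta 2 * opB a₂ b₂ c₂ := by
  refine ⟨?_, ?_, ?_⟩ <;>
  · refine eq_of_mul_right fun y => ?_
    simp only [opA, opB, opC, opU, opV, mul_add, add_mul, mul_sub, sub_mul, mul_assoc,
      smul_mul_assoc, mul_smul_comm, one_mul, theta_mul_z_mul, theta_mul_theta_mul 1 0,
      theta_mul_theta_mul 2 0, theta_mul_theta_mul 2 1, z_mul_z_mul 1 0, z_mul_z_mul 2 0,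
      z_mul_z_mul 2 1, Fin.isValue, Fin.reduceEq, if_true, if_false, add_zero, mul_zero]
    module

/-- The operator `θ₁ + a₁` maps solutions to solutions of the system with `a₁ + 1`. -/
theorem contiguity_a₁ (a₁ a₂ a₃ b₁ b₂ c₁ c₂ : ℂ) :
    opA (a₁ + 1) b₁ c₁ * (theta 0 + a₁ • 1) = (theta 0 + a₁ • 1) * opA a₁ b₁ c₁ ∧
    opB a₂ b₂ c₂ * (theta 0 + a₁ • 1) = (theta 0 + a₁ • 1) * opB a₂ b₂ c₂ ∧
    opC a₃ b₁ c₂ * (theta 0 + a₁ • 1) = (theta 0 + a₁ • 1) * opC a₃ b₁ c₂ := by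
  refine ⟨?_, ?_, ?_⟩ <;>
  · refine eq_of_mul_right fun y => ?_
    simp only [opA, opB, opC, opU, opV, mul_add, add_mul, mul_sub, sub_mul, mul_assoc,
      smul_mul_assoc, mul_smul_comm, one_mul, theta_mul_z_mul, theta_mul_theta_mul 1 0,
      theta_mul_theta_mul 2 0, theta_mul_theta_mul 2 1, z_mul_z_mul 1 0, z_mul_z_mul 2 0,
      z_mul_z_mul 2 1, Fin.isValue, Fin.reduceEq, if_true, if_false, add_zero, mul_zero]
    module

/-- The operator `θ₂ + a₂` maps solutions to solutions of the system with `a₂ + 1`. -/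
theorem contiguity_a₂ (a₁ a₂ a₃ b₁ b₂ c₁ c₂ : ℂ) :
    opA a₁ b₁ c₁ * (theta 1 + a₂ • 1) = (theta 1 + a₂ • 1) * opA a₁ b₁ c₁ ∧
    opB (a₂ + 1) b₂ c₂ * (theta 1 + a₂ • 1) = (theta 1 + a₂ • 1) * opB a₂ b₂ c₂ ∧
    opC a₃ b₁ c₂ * (theta 1 + a₂ • 1) = (theta 1 + a₂ • 1) * opC a₃ b₁ c₂ := by
  refine ⟨?_, ?_, ?_⟩ <;>
  · refine eq_of_mul_right fun y => ?_
    simp only [opA, opB, opC, opU, opV, mul_add, add_mul, mul_sub, sub_mul, mul_assoc,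
      smul_mul_assoc, mul_smul_comm, one_mul, theta_mul_z_mul, theta_mul_theta_mul 1 0,
      theta_mul_theta_mul 2 0, theta_mul_theta_mul 2 1, z_mul_z_mul 1 0, z_mul_z_mul 2 0,
      z_mul_z_mul 2 1, Fin.isValue, Fin.reduceEq, if_true, if_false, add_zero, mul_zero]
    module

/-- The operator `θ₃ + a₃` maps solutions to solutions of the system with `a₃ + 1`. -/
theorem contiguity_a₃ (a₁ a₂ a₃ b₁ b₂ c₁ c₂ : ℂ) :
    opA a₁ b₁ c₁ * (theta 2 + a₃ • 1) = (theta 2 + a₃ • 1) * opA a₁ b₁ c₁ ∧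
    opB a₂ b₂ c₂ * (theta 2 + a₃ • 1) = (theta 2 + a₃ • 1) * opB a₂ b₂ c₂ ∧
    opC (a₃ + 1) b₁ c₂ * (theta 2 + a₃ • 1) = (theta 2 + a₃ • 1) * opC a₃ b₁ c₂ := by
  refine ⟨?_, ?_, ?_⟩ <;>
  · refine eq_of_mul_right fun y => ?_
    simp only [opA, opB, opC, opU, opV, mul_add, add_mul, mul_sub, sub_mul, mul_assoc,
      smul_mul_assoc, mul_smul_comm, one_mul, theta_mul_z_mul, theta_mul_theta_mul 1 0,
      theta_mul_theta_mul 2 0, theta_mul_theta_mul 2 1, z_mul_z_mul 1 0, z_mul_z_mul 2 0,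
      z_mul_z_mul 2 1, Fin.isValue, Fin.reduceEq, if_true, if_false, add_zero, mul_zero]
    module

/-- The operator `θ₁ + θ₃ + b₁` maps solutions to solutions of the system with `b₁ + 1`. -/
theorem contiguity_b₁ (a₁ a₂ a₃ b₁ b₂ c₁ c₂ : ℂ) :
    opA a₁ (b₁ + 1) c₁ * opU b₁ = opU b₁ * opA a₁ b₁ c₁ ∧
    opB a₂ b₂ c₂ * opU b₁ = opU b₁ * opB a₂ b₂ c₂ ∧
    opC a₃ (b₁ + 1) c₂ * opU b₁ = opU b₁ * opC a₃ b₁ c₂ := by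
  refine ⟨?_, ?_, ?_⟩ <;>
  · refine eq_of_mul_right fun y => ?_
    simp only [opA, opB, opC, opU, opV, mul_add, add_mul, mul_sub, sub_mul, mul_assoc,
      smul_mul_assoc, mul_smul_comm, one_mul, theta_mul_z_mul, theta_mul_theta_mul 1 0,
      theta_mul_theta_mul 2 0, theta_mul_theta_mul 2 1, z_mul_z_mul 1 0, z_mul_z_mul 2 0,
      z_mul_z_mul 2 1, Fin.isValue, Fin.reduceEq, if_true, if_false, add_zero, mul_zero]
    module

/-- The operator `θ₂ + θ₃ + c₂ - 1` maps solutions to solutions of the system with `c₂ - 1`. -/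
theorem contiguity_c₂ (a₁ a₂ a₃ b₁ b₂ c₁ c₂ : ℂ) :
    opA a₁ b₁ c₁ * opV c₂ = opV c₂ * opA a₁ b₁ c₁ ∧
    opB a₂ b₂ (c₂ - 1) * opV c₂ = opV (c₂ - 1) * opB a₂ b₂ c₂ ∧
    opC a₃ b₁ (c₂ - 1) * opV c₂ = opV (c₂ - 1) * opC a₃ b₁ c₂ := by
  refine ⟨?_, ?_, ?_⟩ <;>
  · refine eq_of_mul_right fun y => ?_
    simp only [opA, opB, opC, opU, opV, mul_add, add_mul, mul_sub, sub_mul, mul_assoc,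
      smul_mul_assoc, mul_smul_comm, one_mul, theta_mul_z_mul, theta_mul_theta_mul 1 0,
      theta_mul_theta_mul 2 0, theta_mul_theta_mul 2 1, z_mul_z_mul 1 0, z_mul_z_mul 2 0,
      z_mul_z_mul 2 1, Fin.isValue, Fin.reduceEq, if_true, if_false, add_zero, mul_zero]
    module

theorem opB_symm (a₂ b₂ c₂ : ℂ) :
    opB a₂ b₂ c₂ = opB b₂ a₂ c₂ := by
  refine eq_of_mul_right fun y => ?_
  simp only [opA, opB, opC, opU, opV, mul_add, add_mul, mul_sub, sub_mul, mul_assoc,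
    smul_mul_assoc, mul_smul_comm, one_mul, theta_mul_z_mul, theta_mul_theta_mul 1 0,
    theta_mul_theta_mul 2 0, theta_mul_theta_mul 2 1, z_mul_z_mul 1 0, z_mul_z_mul 2 0,
    z_mul_z_mul 2 1, Fin.isValue, Fin.reduceEq, if_true, if_false, add_zero, mul_zero]
  module

theorem opA_zero (b₁ c₁ : ℂ) :
    opA 0 b₁ c₁ =
      (theta 0 + (c₁ - 1) • 1 - mulOp (z 0) * opU b₁) * (theta 0 + (0 : ℂ) • 1) := by
  refine eq_of_mul_right fun y => ?_
  simp only [opA, opB, opC, opU, opV, mul_add, add_mul, mul_sub, sub_mul, mul_assoc,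
    smul_mul_assoc, mul_smul_comm, one_mul, theta_mul_z_mul, theta_mul_theta_mul 1 0,
    theta_mul_theta_mul 2 0, theta_mul_theta_mul 2 1, z_mul_z_mul 1 0, z_mul_z_mul 2 0,
    z_mul_z_mul 2 1, Fin.isValue, Fin.reduceEq, if_true, if_false, add_zero, mul_zero]
  module

theorem opB_zero (b₂ c₂ : ℂ) :
    opB 0 b₂ c₂ = (opV c₂ - mulOp (z 1) * (theta 1 + b₂ • 1)) * (theta 1 + (0 : ℂ) • 1) := by
  refine eq_of_mul_right fun y => ?_
  simp only [opA, opB, opC, opU, opV, mul_add, add_mul, mul_sub, sub_mul, mul_assoc,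
    smul_mul_assoc, mul_smul_comm, one_mul, theta_mul_z_mul, theta_mul_theta_mul 1 0,
    theta_mul_theta_mul 2 0, theta_mul_theta_mul 2 1, z_mul_z_mul 1 0, z_mul_z_mul 2 0,
    z_mul_z_mul 2 1, Fin.isValue, Fin.reduceEq, if_true, if_false, add_zero, mul_zero]
  module

theorem opC_zero (b₁ c₂ : ℂ) :
    opC 0 b₁ c₂ = (opV c₂ - mulOp (z 2) * opU b₁) * (theta 2 + (0 : ℂ) • 1) := by
  refine eq_of_mul_right fun y => ?_
  simp only [opA, opB, opC, opU, opV, mul_add, add_mul, mul_sub, sub_mul, mul_assoc,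
    smul_mul_assoc, mul_smul_comm, one_mul, theta_mul_z_mul, theta_mul_theta_mul 1 0,
    theta_mul_theta_mul 2 0, theta_mul_theta_mul 2 1, z_mul_z_mul 1 0, z_mul_z_mul 2 0,
    z_mul_z_mul 2 1, Fin.isValue, Fin.reduceEq, if_true, if_false, add_zero, mul_zero]
  module

/-- For `b₁ = 0`, a left multiple of `θ₁ + θ₃` of order `3` that lies in the ideal of the system. Modulo
`θ₁ + θ₃` one has `z₁ L₁ ≡ (θ₁ + c₁ - 1) θ₁` and `z₃ L₃ ≡ -(θ₂ + θ₃ + c₂ - 1) θ₁`, whence the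
combination on the left. -/
theorem opV_mul_opA_add_mul_opC (a₁ a₃ c₁ c₂ : ℂ) :
    opV c₂ * opA a₁ 0 c₁ + (theta 0 + (c₁ - 1) • 1) * opC a₃ 0 c₂ =
      ((theta 0 + (c₁ - 1) • 1) * opV c₂ - mulOp (z 0) * ((theta 0 + a₁ • 1) * opV c₂) -
        mulOp (z 2) * ((theta 0 + (c₁ - 1) • 1) * (theta 2 + a₃ • 1))) * opU 0 := by
  refine eq_of_mul_right fun y => ?_
  simp only [opA, opB, opC, opU, opV, mul_add, add_mul, mul_sub, sub_mul, mul_assoc,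
    smul_mul_assoc, mul_smul_comm, one_mul, theta_mul_z_mul, theta_mul_theta_mul 1 0,
    theta_mul_theta_mul 2 0, theta_mul_theta_mul 2 1, z_mul_z_mul 1 0, z_mul_z_mul 2 0,
    z_mul_z_mul 2 1, Fin.isValue, Fin.reduceEq, if_true, if_false, add_zero, mul_zero]
  module

end NormalOrdering

/-! ### The system as an integrable triple -/

theorem mulOp_algebraMap_eq_smul (r : ℂ) : mulOp (algebraMap ℂ RatFun r) = r • 1 := by
  rw [mulOp_algebraMap, Algebra.algebraMap_eq_smul_one]

theorem isIntegrableTriple_op (a₁ a₂ a₃ b₁ b₂ c₁ c₂ : ℂ) :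
    IsIntegrableTriple (opA a₁ b₁ c₁) (opB a₂ b₂ c₂) (opC a₃ b₁ c₂) where
  symbol_A := by
    have e : opA a₁ b₁ c₁ - ((1 - z 0) • mono 2 0 0 - z 0 • mono 1 0 1) =
        (c₁ - 1) • theta 0 -
          z 0 • ((a₁ + b₁) • theta 0 + a₁ • theta 2 + (a₁ * b₁) • (1 : DiffOp)) := by
      simp only [opA, opU, smul_eq_mulOp_mul, mulOp_sub, mulOp_one, mono, pow_zero, pow_one, pow_two,
        mul_add, add_mul, sub_mul, mul_one, one_mul, smul_mul_assoc, mul_smul_comm]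
      module
    rw [e]
    have h (i : Fin 3) (r : ℂ) : r • theta i ∈ ordLT 2 :=
      Submodule.smul_of_tower_mem _ r (theta_mem_ordLT i)
    exact sub_mem (h _ _) (Submodule.smul_mem _ _ (add_mem (add_mem (h _ _) (h _ _))
      (Submodule.smul_of_tower_mem _ _ (ordLT_mono (by omega) one_mem_ordLT))))
  symbol_B := by
    have e : opB a₂ b₂ c₂ - ((1 - z 1) • mono 0 2 0 + mono 0 1 1) =
        (c₂ - 1) • theta 1 - z 1 • ((a₂ + b₂) • theta 1 + (a₂ * b₂) • (1 : DiffOp)) := by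
      simp only [opB, opV, smul_eq_mulOp_mul, mulOp_sub, mulOp_one, mono, pow_zero, pow_one, pow_two,
        mul_add, add_mul, sub_mul, mul_one, one_mul, smul_mul_assoc, mul_smul_comm]
      module
    rw [e]
    have h (i : Fin 3) (r : ℂ) : r • theta i ∈ ordLT 2 :=
      Submodule.smul_of_tower_mem _ r (theta_mem_ordLT i)
    exact sub_mem (h _ _) (Submodule.smul_mem _ _ (add_mem (h _ _)
      (Submodule.smul_of_tower_mem _ _ (ordLT_mono (by omega) one_mem_ordLT))))
  symbol_C := by
    have e : opC a₃ b₁ c₂ - ((1 - z 2) • mono 0 0 2 + mono 0 1 1 - z 2 • mono 1 0 1) =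
        (c₂ - 1) • theta 2 -
          z 2 • ((a₃ + b₁) • theta 2 + a₃ • theta 0 + (a₃ * b₁) • (1 : DiffOp)) := by
      simp only [opC, opU, opV, smul_eq_mulOp_mul, mulOp_sub, mulOp_one, mono, pow_zero, pow_one,
        pow_two, mul_add, add_mul, sub_mul, mul_one, one_mul, smul_mul_assoc, mul_smul_comm,
        theta_comm 2 0, theta_comm 2 1]
      module
    rw [e]
    have h (i : Fin 3) (r : ℂ) : r • theta i ∈ ordLT 2 :=
      Submodule.smul_of_tower_mem _ r (theta_mem_ordLT i)
    exact sub_mem (h _ _) (Submodule.smul_mem _ _ (add_mem (add_mem (h _ _) (h _ _))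
      (Submodule.smul_of_tower_mem _ _ (ordLT_mono (by omega) one_mem_ordLT))))
  comm_AB := (op_commutators a₁ a₂ a₃ b₁ b₂ c₁ c₂).1
  comm_AC := (op_commutators a₁ a₂ a₃ b₁ b₂ c₁ c₂).2.1
  comm_BC := (op_commutators a₁ a₂ a₃ b₁ b₂ c₁ c₂).2.2


/-- The ideal of the system is generated by the operators `z_j L_j` in normal form. -/
theorem systemFN_eq (a₁ a₂ a₃ b₁ b₂ c₁ c₂ : ℂ) : systemFN a₁ a₂ a₃ b₁ b₂ c₁ c₂ =
    Ideal.span {opA a₁ b₁ c₁, opB a₂ b₂ c₂, opC a₃ b₁ c₂} := by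
  have hinv (j : Fin 3) (y : DiffOp) : mulOp (z j)⁻¹ * (mulOp (z j) * y) = y := by
    rw [← mul_assoc, ← mulOp_mul, inv_mul_cancel₀ (z_ne_zero j), mulOp_one, one_mul]
  -- both sides are compared after right multiplication by `z_j`, which cancels `z_j⁻¹`
  have hext (j : Fin 3) {x x' : DiffOp}
      (h : ∀ y, x * (mulOp (z j) * y) = x' * (mulOp (z j) * y)) : x = x' := by
    refine eq_of_mul_right fun y => ?_
    have := h (mulOp (z j)⁻¹ * y)
    rwa [← mul_assoc (mulOp (z j)), ← mulOp_mul, mul_inv_cancel₀ (z_ne_zero j), mulOp_one,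
      one_mul] at this
  have h0 : mulOp (z 0) * opFN a₁ a₂ a₃ b₁ b₂ c₁ c₂ 0 = opA a₁ b₁ c₁ := by
    refine hext 0 fun y => ?_
    simp only [opFN, P, Q, Matrix.cons_val, Algebra.algebraMap_eq_smul_one, opA, opU, mul_add,
      add_mul, mul_sub, sub_mul, mul_assoc, smul_mul_assoc, mul_smul_comm, one_mul, hinv,
      theta_mul_z_mul, Fin.isValue, Fin.reduceEq, if_true, if_false, add_zero]
    module
  have h1 : mulOp (z 1) * opFN a₁ a₂ a₃ b₁ b₂ c₁ c₂ 1 = opB a₂ b₂ c₂ := by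
    refine hext 1 fun y => ?_
    simp only [opFN, P, Q, Matrix.cons_val, Algebra.algebraMap_eq_smul_one, opB, opV, mul_add,
      add_mul, mul_sub, sub_mul, mul_assoc, smul_mul_assoc, mul_smul_comm, one_mul, hinv,
      theta_mul_z_mul, Fin.isValue, Fin.reduceEq, if_true, if_false, add_zero]
    module
  have h2 : mulOp (z 2) * opFN a₁ a₂ a₃ b₁ b₂ c₁ c₂ 2 = opC a₃ b₁ c₂ := by
    refine hext 2 fun y => ?_
    simp only [opFN, P, Q, Matrix.cons_val, Algebra.algebraMap_eq_smul_one, opC, opU, opV, mul_add,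
      add_mul, mul_sub, sub_mul, mul_assoc, smul_mul_assoc, mul_smul_comm, one_mul, hinv,
      theta_mul_z_mul, Fin.isValue, Fin.reduceEq, if_true, if_false, add_zero]
    module
  apply le_antisymm
  · refine Ideal.span_le.2 ?_
    rintro _ ⟨j, rfl⟩
    rw [SetLike.mem_coe, ← hinv j (opFN _ _ _ _ _ _ _ j)]
    refine Ideal.mul_mem_left _ _ ?_
    fin_cases j
    · exact h0 ▸ Ideal.subset_span (by simp)
    · exact h1 ▸ Ideal.subset_span (by simp)
    · exact h2 ▸ Ideal.subset_span (by simp)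
  · refine Ideal.span_le.2 ?_
    rintro _ (rfl | rfl | rfl)
    · exact h0 ▸ Ideal.mul_mem_left _ _ (Ideal.subset_span ⟨0, rfl⟩)
    · exact h1 ▸ Ideal.mul_mem_left _ _ (Ideal.subset_span ⟨1, rfl⟩)
    · exact h2 ▸ Ideal.mul_mem_left _ _ (Ideal.subset_span ⟨2, rfl⟩)

theorem finrank_systemFN (a₁ a₂ a₃ b₁ b₂ c₁ c₂ : ℂ) :
    Module.finrank RatFun (DiffOp ⧸ systemFN a₁ a₂ a₃ b₁ b₂ c₁ c₂) = 8 := by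
  rw [systemFN_eq]
  exact (isIntegrableTriple_op ..).finrank_quotient

/-- The system is symmetric in the parameters `a₂` and `b₂`. -/
theorem systemFN_symm (a₁ a₂ a₃ b₁ b₂ c₁ c₂ : ℂ) :
    systemFN a₁ a₂ a₃ b₁ b₂ c₁ c₂ = systemFN a₁ b₂ a₃ b₁ a₂ c₁ c₂ := by
  rw [systemFN_eq, systemFN_eq, opB_symm]

/-- Combinations of squarefree monomials in the ideal of the system have zero coefficients. -/
theorem coeff_eq_zero_of_mem {a₁ a₂ a₃ b₁ b₂ c₁ c₂ : ℂ} {w r₀ r₁ r₂ r₀₁ r₀₂ r₁₂ : RatFun}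
    {x : DiffOp} (hx : x ∈ systemFN a₁ a₂ a₃ b₁ b₂ c₁ c₂)
    (e : x = w • 1 + r₀ • theta 0 + r₁ • theta 1 + r₂ • theta 2 + r₀₁ • (theta 0 * theta 1) +
      r₀₂ • (theta 0 * theta 2) + r₁₂ • (theta 1 * theta 2)) :
    r₀ = 0 ∧ r₁ = 0 ∧ r₂ = 0 ∧ r₀₁ = 0 := by
  rw [systemFN_eq] at hx
  have h := (isIntegrableTriple_op a₁ a₂ a₃ b₁ b₂ c₁ c₂).coeff_eq_zero
    ![![![w, r₂], ![r₁, r₁₂]], ![![r₀, r₀₂], ![r₀₁, 0]]] (by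
      convert hx using 1
      rw [e]
      simp only [Fin.sum_univ_two, mono, Matrix.cons_val_zero, Matrix.cons_val_one, Fin.val_zero,
        Fin.val_one, pow_zero, pow_one, one_mul, mul_one, zero_smul]
      abel)
  exact ⟨h 1 0 0, h 0 1 0, h 0 0 1, h 1 1 0⟩

/-! ### Contiguity and reducibility -/

/-- Right multiplication by `X` maps the ideal of one system to that of another one if it does so,
up to a left factor, with the generators. -/
theorem mul_mem_systemFN {a₁ a₂ a₃ b₁ b₂ c₁ c₂ a₁' a₂' a₃' b₁' b₂' c₁' c₂' : ℂ}
    {X XA XB XC : DiffOp} (h : opA a₁' b₁' c₁' * X = XA * opA a₁ b₁ c₁ ∧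
      opB a₂' b₂' c₂' * X = XB * opB a₂ b₂ c₂ ∧ opC a₃' b₁' c₂' * X = XC * opC a₃ b₁ c₂) :
    ∀ y ∈ systemFN a₁' a₂' a₃' b₁' b₂' c₁' c₂', y * X ∈ systemFN a₁ a₂ a₃ b₁ b₂ c₁ c₂ := by
  obtain ⟨hA, hB, hC⟩ := h
  intro y hy
  rw [systemFN_eq] at hy ⊢
  rw [Ideal.span, Submodule.mem_span_triple] at hy
  obtain ⟨a, b, c, rfl⟩ := hy
  simp only [smul_eq_mul, add_mul, mul_assoc, hA, hB, hC]
  refine add_mem (add_mem ?_ ?_) ?_ <;>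
  · rw [← mul_assoc]
    exact Ideal.mul_mem_left _ _ (Ideal.subset_span (by simp))

theorem theta_add_notMem (a₁ a₂ a₃ b₁ b₂ c₁ c₂ r : ℂ) (i : Fin 3) :
    theta i + r • 1 ∉ systemFN a₁ a₂ a₃ b₁ b₂ c₁ c₂ := by
  intro hx
  have h := coeff_eq_zero_of_mem (w := algebraMap ℂ RatFun r) (r₀ := if i = 0 then 1 else 0)
    (r₁ := if i = 1 then 1 else 0) (r₂ := if i = 2 then 1 else 0) (r₀₁ := 0) (r₀₂ := 0) (r₁₂ := 0)
    hx (by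
      rw [smul_eq_mulOp_mul, mulOp_algebraMap_eq_smul]
      fin_cases i <;> simp [add_comm])
  fin_cases i <;> simp at h

theorem opU_notMem (a₁ a₂ a₃ b₁ b₂ c₁ c₂ r : ℂ) : opU r ∉ systemFN a₁ a₂ a₃ b₁ b₂ c₁ c₂ := by
  intro hx
  have h := coeff_eq_zero_of_mem (w := algebraMap ℂ RatFun r) (r₀ := 1) (r₁ := 0) (r₂ := 1)
    (r₀₁ := 0) (r₀₂ := 0) (r₁₂ := 0) hx (by
      rw [opU, smul_eq_mulOp_mul, mulOp_algebraMap_eq_smul]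
      simp only [one_smul, zero_smul, smul_mul_assoc, one_mul]
      abel)
  exact one_ne_zero h.1

theorem opV_notMem (a₁ a₂ a₃ b₁ b₂ c₁ c₂ r : ℂ) : opV r ∉ systemFN a₁ a₂ a₃ b₁ b₂ c₁ c₂ := by
  intro hx
  have h := coeff_eq_zero_of_mem (w := algebraMap ℂ RatFun (r - 1)) (r₀ := 0) (r₁ := 1) (r₂ := 1)
    (r₀₁ := 0) (r₀₂ := 0) (r₁₂ := 0) hx (by
      rw [opV, smul_eq_mulOp_mul, mulOp_algebraMap_eq_smul]
      simp only [one_smul, zero_smul, smul_mul_assoc, one_mul]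
      abel)
  exact one_ne_zero h.2.1

/-- For `a₁ = 0` the operator `L₁` is a left multiple of `θ₁`, so that right multiplication by `θ₁` is not
injective. -/
theorem isReducible_of_a₁ (n : ℤ) (a₂ a₃ b₁ b₂ c₁ c₂ : ℂ) :
    IsReducible (systemFN n a₂ a₃ b₁ b₂ c₁ c₂) := by
  refine isReducible_of_chain (by omega : 0 < 8) (fun t : ℤ => systemFN t a₂ a₃ b₁ b₂ c₁ c₂)
    (fun t => finrank_systemFN ..) (fun t => theta 0 + (t : ℂ) • 1) (fun t => ?_)
    (fun t => theta_add_notMem _ _ _ _ _ _ _ _ _) ?_ n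
  · rw [Int.cast_add, Int.cast_one]
    exact mul_mem_systemFN (contiguity_a₁ ..)
  · refine not_bijective_of_mul_mem _ (Y := theta 0 + (c₁ - 1) • 1 - mulOp (z 0) * opU b₁)
      (fun hY => ?_) ?_
    · have h := coeff_eq_zero_of_mem
        (w := algebraMap ℂ RatFun (c₁ - 1) - z 0 * algebraMap ℂ RatFun b₁)
        (r₀ := 1 - z 0) (r₁ := 0) (r₂ := -z 0) (r₀₁ := 0) (r₀₂ := 0) (r₁₂ := 0) hY (by
          simp only [opU, zero_smul, neg_smul, sub_smul, one_smul, smul_eq_mulOp_mul,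
            mulOp_mul, mulOp_algebraMap_eq_smul, mul_add, mul_smul_comm, mul_one]
          abel)
      exact one_sub_z_ne_zero 0 h.1
    · rw [systemFN_eq, Int.cast_zero, ← opA_zero]
      exact Ideal.subset_span (by simp)

/-- For `a₂ = 0` the operator `L₂` is a left multiple of `θ₂`. -/
theorem isReducible_of_a₂ (n : ℤ) (a₁ a₃ b₁ b₂ c₁ c₂ : ℂ) :
    IsReducible (systemFN a₁ n a₃ b₁ b₂ c₁ c₂) := by
  refine isReducible_of_chain (by omega : 0 < 8) (fun t : ℤ => systemFN a₁ t a₃ b₁ b₂ c₁ c₂)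
    (fun t => finrank_systemFN ..) (fun t => theta 1 + (t : ℂ) • 1) (fun t => ?_)
    (fun t => theta_add_notMem _ _ _ _ _ _ _ _ _) ?_ n
  · rw [Int.cast_add, Int.cast_one]
    exact mul_mem_systemFN (contiguity_a₂ ..)
  · refine not_bijective_of_mul_mem _ (Y := opV c₂ - mulOp (z 1) * (theta 1 + b₂ • 1))
      (fun hY => ?_) ?_
    · have h := coeff_eq_zero_of_mem
        (w := algebraMap ℂ RatFun (c₂ - 1) - z 1 * algebraMap ℂ RatFun b₂)
        (r₀ := 0) (r₁ := 1 - z 1) (r₂ := 1) (r₀₁ := 0) (r₀₂ := 0) (r₁₂ := 0) hY (by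
          simp only [opV, zero_smul, sub_smul, one_smul, smul_eq_mulOp_mul,
            mulOp_mul, mulOp_algebraMap_eq_smul, mul_add, mul_smul_comm, mul_one]
          abel)
      exact one_ne_zero h.2.2.1
    · rw [systemFN_eq, Int.cast_zero, ← opB_zero]
      exact Ideal.subset_span (by simp)

/-- For `a₃ = 0` the operator `L₃` is a left multiple of `θ₃`. -/
theorem isReducible_of_a₃ (n : ℤ) (a₁ a₂ b₁ b₂ c₁ c₂ : ℂ) :
    IsReducible (systemFN a₁ a₂ n b₁ b₂ c₁ c₂) := by
  refine isReducible_of_chain (by omega : 0 < 8) (fun t : ℤ => systemFN a₁ a₂ t b₁ b₂ c₁ c₂)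
    (fun t => finrank_systemFN ..) (fun t => theta 2 + (t : ℂ) • 1) (fun t => ?_)
    (fun t => theta_add_notMem _ _ _ _ _ _ _ _ _) ?_ n
  · rw [Int.cast_add, Int.cast_one]
    exact mul_mem_systemFN (contiguity_a₃ ..)
  · refine not_bijective_of_mul_mem _ (Y := opV c₂ - mulOp (z 2) * opU b₁) (fun hY => ?_) ?_
    · have h := coeff_eq_zero_of_mem
        (w := algebraMap ℂ RatFun (c₂ - 1) - z 2 * algebraMap ℂ RatFun b₁)
        (r₀ := -z 2) (r₁ := 1) (r₂ := 1 - z 2) (r₀₁ := 0) (r₀₂ := 0) (r₁₂ := 0) hY (by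
          simp only [opU, opV, zero_smul, neg_smul, sub_smul, one_smul, smul_eq_mulOp_mul,
            mulOp_mul, mulOp_algebraMap_eq_smul, mul_add, mul_smul_comm, mul_one]
          abel)
      exact one_ne_zero h.2.1
    · rw [systemFN_eq, Int.cast_zero, ← opC_zero]
      exact Ideal.subset_span (by simp)

/-- For `b₁ = 0` the ideal contains a left multiple `Y (θ₁ + θ₃)` whose cofactor `Y` has order `2`
and, with its squarefree principal symbol, does not belong to the ideal of the system with `b₁ = 1`. -/
theorem isReducible_of_b₁ (n : ℤ) (a₁ a₂ a₃ b₂ c₁ c₂ : ℂ) :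
    IsReducible (systemFN a₁ a₂ a₃ n b₂ c₁ c₂) := by
  refine isReducible_of_chain (by omega : 0 < 8) (fun t : ℤ => systemFN a₁ a₂ a₃ t b₂ c₁ c₂)
    (fun t => finrank_systemFN ..) (fun t => opU t) (fun t => ?_)
    (fun t => opU_notMem _ _ _ _ _ _ _ _) ?_ n
  · rw [Int.cast_add, Int.cast_one]
    exact mul_mem_systemFN (contiguity_b₁ ..)
  · refine not_bijective_of_mul_mem _ (Y := (theta 0 + (c₁ - 1) • 1) * opV c₂ -
      mulOp (z 0) * ((theta 0 + a₁ • 1) * opV c₂) -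
      mulOp (z 2) * ((theta 0 + (c₁ - 1) • 1) * (theta 2 + a₃ • 1))) (fun hY => ?_) ?_
    · have h := coeff_eq_zero_of_mem
        (w := algebraMap ℂ RatFun ((c₁ - 1) * (c₂ - 1)) - z 0 * algebraMap ℂ RatFun (a₁ * (c₂ - 1)) -
          z 2 * algebraMap ℂ RatFun ((c₁ - 1) * a₃))
        (r₀ := algebraMap ℂ RatFun (c₂ - 1) - z 0 * algebraMap ℂ RatFun (c₂ - 1) -
          z 2 * algebraMap ℂ RatFun a₃)
        (r₁ := algebraMap ℂ RatFun (c₁ - 1) - z 0 * algebraMap ℂ RatFun a₁)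
        (r₂ := algebraMap ℂ RatFun (c₁ - 1) - z 0 * algebraMap ℂ RatFun a₁ -
          z 2 * algebraMap ℂ RatFun (c₁ - 1))
        (r₀₁ := 1 - z 0) (r₀₂ := 1 - z 0 - z 2) (r₁₂ := 0) hY (by
          simp only [opV, zero_smul, smul_eq_mulOp_mul, mulOp_sub, mulOp_one,
            mulOp_mul, mulOp_algebraMap_eq_smul, mul_add, add_mul, sub_mul,
            smul_mul_assoc, mul_smul_comm, mul_one, one_mul]
          module)
      exact one_sub_z_ne_zero 0 h.2.2.2
    · rw [Int.cast_zero, ← opV_mul_opA_add_mul_opC, systemFN_eq]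
      exact add_mem (Ideal.mul_mem_left _ _ (Ideal.subset_span (by simp)))
        (Ideal.mul_mem_left _ _ (Ideal.subset_span (by simp)))

theorem symbolAt_smul (ρ : Fin 3 → ℂ) (r : ℂ) (x : DiffOp) :
    symbolAt ρ (r • x) = algebraMap ℂ RatFun r * symbolAt ρ x := by
  rw [symbolAt, map_smul, LinearMap.smul_apply, Algebra.smul_def, symbolAt]

theorem symbolAt_mul_theta_add (ρ : Fin 3 → ℂ) (x : DiffOp) (i : Fin 3) (r : ℂ) :
    symbolAt ρ (x * (theta i + r • 1)) = algebraMap ℂ RatFun (ρ i + r) * symbolAt ρ x := by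
  rw [mul_add, symbolAt_add, symbolAt_mul_theta, mul_smul_comm, mul_one, symbolAt_smul, map_add,
    add_mul]

theorem symbolAt_mul_opU (ρ : Fin 3 → ℂ) (x : DiffOp) (b₁ : ℂ) :
    symbolAt ρ (x * opU b₁) = algebraMap ℂ RatFun (ρ 0 + ρ 2 + b₁) * symbolAt ρ x := by
  rw [opU, add_assoc, mul_add, symbolAt_add, symbolAt_mul_theta, symbolAt_mul_theta_add, ← add_mul,
    ← map_add, add_assoc]

theorem symbolAt_mul_opV (ρ : Fin 3 → ℂ) (x : DiffOp) (c₂ : ℂ) :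
    symbolAt ρ (x * opV c₂) = algebraMap ℂ RatFun (ρ 1 + ρ 2 + (c₂ - 1)) * symbolAt ρ x := by
  rw [opV, add_assoc, mul_add, symbolAt_add, symbolAt_mul_theta, symbolAt_mul_theta_add, ← add_mul,
    ← map_add, add_assoc]

theorem symbolAt_sub (ρ : Fin 3 → ℂ) (x y : DiffOp) :
    symbolAt ρ (x - y) = symbolAt ρ x - symbolAt ρ y := by simp [symbolAt]

theorem symbolAt_mul_eq_zero {ρ : Fin 3 → ℂ} (x : DiffOp) {y : DiffOp} (h : symbolAt ρ y = 0) :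
    symbolAt ρ (x * y) = 0 := by
  rw [symbolAt, map_mul, Module.End.mul_apply]
  rw [symbolAt] at h
  rw [h, map_zero]

/-- A monomial `z₁^s z₂^(-a₂) z₃^(a₂ - γ + 1)` that solves the system with `c₂ = γ` and is killed by
the contiguity operator in `c₂` makes all the systems with `c₂ ∈ γ + ℤ` reducible. -/
theorem isReducible_of_monomial_solution (a₁ a₂ a₃ b₁ b₂ c₁ γ s : ℂ)
    (hs : s * (s + (c₁ - 1)) = 0) (hγ : s + (a₂ - γ + 1) + b₁ = 0) (n : ℤ) :
    IsReducible (systemFN a₁ a₂ a₃ b₁ b₂ c₁ (γ - n)) := by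
  refine isReducible_of_chain (by omega : 0 < 8)
    (fun t : ℤ => systemFN a₁ a₂ a₃ b₁ b₂ c₁ (γ - t))
    (fun t => finrank_systemFN ..) (fun t => opV (γ - t)) (fun t => ?_)
    (fun t => opV_notMem _ _ _ _ _ _ _ _) ?_ n
  · have e : γ - ((t + 1 : ℤ) : ℂ) = γ - t - 1 := by push_cast; ring
    rw [e]
    exact mul_mem_systemFN (contiguity_c₂ ..)
  · set ρ : Fin 3 → ℂ := ![s, -a₂, a₂ - γ + 1] with hρ
    -- `v` kills `z^ρ`, and so do the right factors `u` and `θ₂ + a₂` of the terms of the operators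
    -- `z_j L_j` that involve `z_j`
    have hu : ρ 0 + ρ 2 + b₁ = 0 := by simpa [hρ] using hγ
    have hv : ρ 1 + ρ 2 + (γ - 1) = 0 := by simp [hρ]; ring
    have hV (x : DiffOp) : symbolAt ρ (x * opV γ) = 0 := by
      rw [symbolAt_mul_opV, hv, map_zero, zero_mul]
    have hU (x : DiffOp) : symbolAt ρ (x * opU b₁) = 0 := by
      rw [symbolAt_mul_opU, hu, map_zero, zero_mul]
    have hA : symbolAt ρ (opA a₁ b₁ c₁) = 0 := by
      rw [opA, symbolAt_sub, symbolAt_mulOp_mul, hU, symbolAt_mul_theta_add, ← one_mul (theta 0),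
        symbolAt_mul_theta, ← mul_assoc, ← map_mul, mul_comm (ρ 0 + _)]
      have : ρ 0 * (ρ 0 + (c₁ - 1)) = 0 := hs
      rw [this, map_zero, zero_mul, mul_zero, sub_zero]
    have hB : symbolAt ρ (opB a₂ b₂ γ) = 0 := by
      have : ρ 1 + a₂ = 0 := by simp [hρ]
      rw [opB_symm, opB, symbolAt_sub, symbolAt_mulOp_mul, hV, symbolAt_mul_theta_add, this, map_zero,
        zero_mul, mul_zero, sub_zero]
    have hC : symbolAt ρ (opC a₃ b₁ γ) = 0 := by
      rw [opC, symbolAt_sub, symbolAt_mulOp_mul, hV, hU, mul_zero, sub_zero]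
    refine not_bijective_of_symbolAt _ ρ (fun y hy => ?_) ?_
    · rw [Int.cast_zero, sub_zero, systemFN_eq, Ideal.span, Submodule.mem_span_triple] at hy
      obtain ⟨a, b, c, rfl⟩ := hy
      rw [smul_eq_mul, smul_eq_mul, smul_eq_mul, symbolAt_add, symbolAt_add,
        symbolAt_mul_eq_zero a hA, symbolAt_mul_eq_zero b hB, symbolAt_mul_eq_zero c hC, add_zero,
        add_zero]
    · rw [Int.cast_zero, sub_zero]
      simpa using hV 1

/-- The monomial solution, for `c₂ = a₂ + b₁ - c₁ + 2`, is `z₁^(1 - c₁) z₂^(-a₂) z₃^(c₁ - 1 - b₁)`. -/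
theorem isReducible_of_exponent₁ (n : ℤ) (a₁ a₂ a₃ b₁ b₂ c₁ c₂ : ℂ)
    (h : a₂ - c₁ - c₂ + b₁ = n) : IsReducible (systemFN a₁ a₂ a₃ b₁ b₂ c₁ c₂) := by
  have e : c₂ = a₂ + b₁ - c₁ + 2 - ((n + 2 : ℤ) : ℂ) := by push_cast; rw [← h]; ring
  rw [e]
  exact isReducible_of_monomial_solution a₁ a₂ a₃ b₁ b₂ c₁ _ (1 - c₁) (by ring) (by ring) _

/-- The monomial solution, for `c₂ = a₂ + b₁ + 1`, is `z₂^(-a₂) z₃^(-b₁)`. -/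
theorem isReducible_of_exponent₂ (n : ℤ) (a₁ a₂ a₃ b₁ b₂ c₁ c₂ : ℂ)
    (h : a₂ - c₂ + b₁ = n) : IsReducible (systemFN a₁ a₂ a₃ b₁ b₂ c₁ c₂) := by
  have e : c₂ = a₂ + b₁ + 1 - ((n + 1 : ℤ) : ℂ) := by push_cast; rw [← h]; ring
  rw [e]
  exact isReducible_of_monomial_solution a₁ a₂ a₃ b₁ b₂ c₁ _ 0 (by ring) (by ring) _

end FNSystem

theorem theorem2 (a₁ a₂ a₃ b₁ b₂ c₁ c₂ : ℂ)
    (h : ∃ n : ℤ,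
      a₁ = n ∨ a₂ = n ∨ a₃ = n ∨ b₁ = n ∨ b₂ = n ∨
      a₂ - c₁ - c₂ + b₁ = n ∨ a₂ - c₂ + b₁ = n ∨
      b₂ - c₁ - c₂ + b₁ = n ∨ b₂ - c₂ + b₁ = n) :
    FNSystem.IsReducible (FNSystem.systemFN a₁ a₂ a₃ b₁ b₂ c₁ c₂) := by
  obtain ⟨n, rfl | rfl | rfl | rfl | rfl | h | h | h | h⟩ := h
  · exact FNSystem.isReducible_of_a₁ ..
  · exact FNSystem.isReducible_of_a₂ ..
  · exact FNSystem.isReducible_of_a₃ ..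
  · exact FNSystem.isReducible_of_b₁ ..
  · rw [FNSystem.systemFN_symm]
    exact FNSystem.isReducible_of_a₂ ..
  · exact FNSystem.isReducible_of_exponent₁ n _ _ _ _ _ _ _ h
  · exact FNSystem.isReducible_of_exponent₂ n _ _ _ _ _ _ _ h
  · rw [FNSystem.systemFN_symm]
    exact FNSystem.isReducible_of_exponent₁ n _ _ _ _ _ _ _ h
  · rw [FNSystem.systemFN_symm]
    exact FNSystem.isReducible_of_exponent₂ n _ _ _ _ _ _ _ h
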